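/- Let $d\in\{2,3\}$ and $\sigma>0$. There is a constant $C$, depending only on $d$ and $\sigma$, with the following property. Let $\Omega\subset\mathbb R^d$ be a bounded open convex polytopal domain, let $\mathbf f\in L^\infty(\Omega)^d$, and let $(\mathbf y,p)\in H^1_0(\Omega)^d\times L^2(\Omega)/\mathbb R$ be the weak solution of the Stokes problem $$a(\mathbf y,\mathbf v)+b(\mathbf v,p)=\int_\Omega\mathbf f\cdot\mathbf v\quad\forall\,\mathbf v\in H^1_0(\Omega)^d,\qquad b(\mathbf y,q)=0\quad\forall\,q\in L^2(\Omega)/\mathbb R,$$ where $a(\mathbf w,\mathbf v)=\int_\Omega\nabla\mathbf w:\nabla\mathbf v$ and $b(\mathbf v,q)=-\int_\Omega q\,\mathrm{div}\,\mathbf v$. Let $\mathscr T$ be a conforming partition of $\overline\Omega$ into finitely many closed $d$-simplices which is shape regular with constant $\sigma$: every $T\in\mathscr T$ contains a ball of diameter at least $h_T/\sigma$, where $h_T=\mathrm{diam}(T)$. Let $$\mathbf V(\mathscr T)=\{\mathbf v\in C(\overline\Omega)^d:\mathbf v|_T\in\mathbb P_2(T)^d\ \forall T\in\mathscr T\}\cap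 H^1_0(\Omega)^d,$$ $$Q(\mathscr T)=\{q\in C(\overline\Omega):q|_T\in\mathbb P_1(T)\ \forall T\in\mathscr T\}\ \text{(modulo constants)}$$ be the Taylor–Hood spaces, and let $(\mathbf y_{\mathscr T},p_{\mathscr T})\in\mathbf V(\mathscr T)\times Q(\mathscr T)$ solve $$a(\mathbf y_{\mathscr T},\mathbf v)+b(\mathbf v,p_{\mathscr T})=\int_\Omega\mathbf f\cdot\mathbf v\quad\forall\,\mathbf v\in\mathbf V(\mathscr T),\qquad b(\mathbf y_{\mathscr T},q)=0\quad\forall\,q\in Q(\mathscr T).$$ Then, for every $T\in\mathscr T$, the local indicator $$\mathcal E_{\infty,T}:=h_T^2\|\mathbf f+\Delta\mathbf y_{\mathscr T}-\nabla p_{\mathscr T}\|_{L^\infty(T)}+\tfrac{h_T}{2}\|[\![\nabla\mathbf y_{\mathscr T}\cdot\boldsymbol\nu]\!]\|_{L^\infty(\partial T\setminus\partial\Omega)}+h_T\|\mathrm{div}\,\mathbf y_{\mathscr T}\|_{L^\infty(T)}$$ satisfies $$\mathcal E_{\infty,T}\le C\Big(\|\mathbf y-\mathbf y_{\mathscr T}\|_{L^\infty(\mathcal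 N_T)}+h_T\|p-p_{\mathscr T}\|_{L^\infty(\mathcal N_T)}+\mathrm{osc}_\infty(\mathbf f;\mathcal N_T)\Big).$$ Here $[\![\nabla\mathbf w\cdot\boldsymbol\nu]\!]=\nabla\mathbf w|_{T^+}\boldsymbol\nu^++\nabla\mathbf w|_{T^-}\boldsymbol\nu^-$ on an internal side shared by $T^+$ and $T^-$, with unit normals $\boldsymbol\nu^\pm$ pointing towards $T^\pm$; $\mathcal N_T$ is the union of $T$ and of all elements of $\mathscr T$ that share a $(d-1)$-dimensional side with $T$; and $$\mathrm{osc}_\infty(\mathbf f;\mathcal N_T)=\max_{T'\in\mathscr T,\ T'\subset\mathcal N_T}h_{T'}^2\|\mathbf f-\Pi_{\mathscr T}\mathbf f\|_{L^\infty(T')},$$ where $\Pi_{\mathscr T}$ is the $L^2$-orthogonal projection onto the (discontinuous) piecewise affine vector fields on $\mathscr T$. The estimate holds for every choice of representatives of $p$ and $p_{\mathscr T}$ modulo constants (in particular those of mean zero), and as an inequality in $[0,\infty]$. -/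

import Mathlib

open MeasureTheory Set
open scoped ENNReal NNReal ContDiff

noncomputable section

namespace TaylorHood

/-- The Euclidean space `ℝ^d`. -/
abbrev E (d : ℕ) : Type := EuclideanSpace ℝ (Fin d)

variable {d : ℕ}

/-! ### Domain and Sobolev spaces -/

/-- `Ω` is a bounded open convex polytopal domain: the nonempty interior of the convex hull of
finitely many points. (Such a set always has a Lipschitz boundary.) -/
def IsConvexPolytopalDomain (Ω : Set (E d)) : Prop :=
  Ω.Nonempty ∧ ∃ V : Finset (E d), Ω = interior (convexHull ℝ (V : Set (E d)))

/-- `φ ∈ C_c^∞(Ω)`. -/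
def IsTestFunction (Ω : Set (E d)) (φ : E d → ℝ) : Prop :=
  ContDiff ℝ ∞ φ ∧ HasCompactSupport φ ∧ tsupport φ ⊆ Ω

/-- `g` is a weak gradient of the scalar function `u` on `Ω`. -/
def HasWeakGrad (Ω : Set (E d)) (u : E d → ℝ) (g : E d → E d) : Prop :=
  LocallyIntegrableOn u Ω ∧ LocallyIntegrableOn g Ω ∧
    ∀ φ : E d → ℝ, IsTestFunction Ω φ → ∀ i : Fin d,
      ∫ x in Ω, u x * gradient φ x i = - ∫ x in Ω, g x i * φ x

open Classical in
/-- The weak gradient of `u` on `Ω` (unique up to null sets), and `0` if there is none. -/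
def weakGrad (Ω : Set (E d)) (u : E d → ℝ) : E d → E d :=
  if h : ∃ g, HasWeakGrad Ω u g then h.choose else 0

/-- `u ∈ H^1(Ω)`. -/
def MemH1 (Ω : Set (E d)) (u : E d → ℝ) : Prop :=
  MemLp u 2 (volume.restrict Ω) ∧ (∃ g, HasWeakGrad Ω u g) ∧
    MemLp (weakGrad Ω u) 2 (volume.restrict Ω)

/-- `u ∈ H^1_0(Ω)`, the closure of `C_c^∞(Ω)` in `H^1(Ω)`. -/
def MemH01 (Ω : Set (E d)) (u : E d → ℝ) : Prop :=
  MemH1 Ω u ∧ ∀ ε : ℝ≥0∞, 0 < ε → ∃ φ : E d → ℝ, IsTestFunction Ω φ ∧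
    eLpNorm (fun x => u x - φ x) 2 (volume.restrict Ω) ≤ ε ∧
    eLpNorm (fun x => weakGrad Ω u x - gradient φ x) 2 (volume.restrict Ω) ≤ ε

/-- `v ∈ H^1_0(Ω)^d`, componentwise. -/
def MemH01Vec (Ω : Set (E d)) (v : E d → E d) : Prop :=
  ∀ i : Fin d, MemH01 Ω (fun x => v x i)

/-! ### The Stokes problem -/

/-- `a(w, v) = ∫_Ω ∇w : ∇v = ∑ᵢ ∫_Ω ∇wᵢ · ∇vᵢ`. -/
def formA (Ω : Set (E d)) (w v : E d → E d) : ℝ :=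
  ∑ i : Fin d, ∫ x in Ω,
    inner ℝ (weakGrad Ω (fun z => w z i) x) (weakGrad Ω (fun z => v z i) x)

/-- `b(v, q) = -∫_Ω q div v`. -/
def formB (Ω : Set (E d)) (v : E d → E d) (q : E d → ℝ) : ℝ :=
  - ∫ x in Ω, q x * ∑ i : Fin d, weakGrad Ω (fun z => v z i) x i

/-- `(y, p) ∈ H^1_0(Ω)^d × L²(Ω)/ℝ` is a weak solution of the Stokes equations with right-hand
side `f`. The class of the pressure in `L²(Ω)/ℝ` is given by an arbitrary representative `p`; as
`∫_Ω div v = 0` for `v ∈ H^1_0(Ω)^d`, both equations are insensitive to additive constants in `p`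
and in the test functions `q`. -/
structure IsStokesSolution (Ω : Set (E d)) (f y : E d → E d) (p : E d → ℝ) : Prop where
  memH01 : MemH01Vec Ω y
  memL2 : MemLp p 2 (volume.restrict Ω)
  momentum : ∀ v : E d → E d, MemH01Vec Ω v →
    formA Ω y v + formB Ω v p = ∫ x in Ω, inner ℝ (f x) (v x)
  incompressible : ∀ q : E d → ℝ, MemLp q 2 (volume.restrict Ω) → formB Ω y q = 0

/-! ### Meshes -/

/-- The closed simplex with vertex set `T`. -/
def cell (T : Finset (E d)) : Set (E d) := convexHull ℝ (T : Set (E d))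

/-- `h_T`, the diameter of the simplex with vertex set `T`. -/
def size (T : Finset (E d)) : ℝ := Metric.diam (cell T)

/-- The simplicial complex `K` is a conforming partition of `closure Ω` into finitely many
`d`-dimensional simplices. The elements of the mesh are the facets (maximal faces) of `K`, each
one given by its set of vertices. -/
structure IsMesh (Ω : Set (E d)) (K : Geometry.SimplicialComplex ℝ (E d)) : Prop where
  finite : K.faces.Finite
  space_eq : K.space = closure Ω
  card_facet : ∀ T ∈ K.facets, T.card = d + 1

/-- Shape regularity: every element `T` contains a ball of diameter at least `h_T / σ`. -/
def IsShapeRegular (K : Geometry.SimplicialComplex ℝ (E d)) (σ : ℝ) : Prop :=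
  ∀ T ∈ K.facets, ∃ (c : E d) (r : ℝ), 0 < r ∧ Metric.closedBall c r ⊆ cell T ∧
    size T ≤ σ * (2 * r)

/-- `𝒮`, the internal sides: `(d-1)`-dimensional faces shared by two distinct elements. -/
def internalSides (K : Geometry.SimplicialComplex ℝ (E d)) : Set (Finset (E d)) :=
  {S | S ∈ K.faces ∧ S.card = d ∧
    ∃ T₁ ∈ K.facets, ∃ T₂ ∈ K.facets, T₁ ≠ T₂ ∧ S ⊆ T₁ ∧ S ⊆ T₂}

/-- `𝒮_T`, the internal sides that are sides of `T`. -/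
def sidesOf (K : Geometry.SimplicialComplex ℝ (E d)) (T : Finset (E d)) : Set (Finset (E d)) :=
  {S | S ∈ internalSides K ∧ S ⊆ T}

/-- The elements of the patch of `T`: the element `T` itself and those sharing a side with it. -/
def patchElements (K : Geometry.SimplicialComplex ℝ (E d)) (T : Finset (E d)) :
    Set (Finset (E d)) :=
  {T' | T' ∈ K.facets ∧ (T' = T ∨ (sidesOf K T ∩ sidesOf K T').Nonempty)}

/-- `𝒩_T` as a subset of `closure Ω`. -/
def patch (K : Geometry.SimplicialComplex ℝ (E d)) (T : Finset (E d)) : Set (E d) :=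
  ⋃ T' ∈ patchElements K T, cell T'

/-! ### Taylor–Hood discretization -/

/-- On the set `s`, the function `u` is a polynomial of total degree at most `k`. -/
def IsPolyOn (k : ℕ) (s : Set (E d)) (u : E d → ℝ) : Prop :=
  ∃ P : MvPolynomial (Fin d) ℝ, P.totalDegree ≤ k ∧
    ∀ x ∈ s, u x = MvPolynomial.eval (fun j => x j) P

/-- The velocity space `V(𝒯)`: continuous, piecewise quadratic, in `H^1_0(Ω)^d`. -/
def MemV (Ω : Set (E d)) (K : Geometry.SimplicialComplex ℝ (E d)) (v : E d → E d) : Prop :=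
  ContinuousOn v (closure Ω) ∧ (∀ T ∈ K.facets, ∀ i, IsPolyOn 2 (cell T) (fun x => v x i)) ∧
    MemH01Vec Ω v

/-- The pressure space `Q(𝒯)`: continuous, piecewise linear. As for `L²(Ω)/ℝ`, its elements are
given by arbitrary representatives modulo constants. -/
def MemQ (Ω : Set (E d)) (K : Geometry.SimplicialComplex ℝ (E d)) (q : E d → ℝ) : Prop :=
  ContinuousOn q (closure Ω) ∧ ∀ T ∈ K.facets, IsPolyOn 1 (cell T) q

/-- `(yT, pT)` solves the Taylor–Hood discretization of the Stokes problem on the mesh `K`. -/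
structure IsDiscreteStokesSolution (Ω : Set (E d)) (K : Geometry.SimplicialComplex ℝ (E d))
    (f yT : E d → E d) (pT : E d → ℝ) : Prop where
  memV : MemV Ω K yT
  memQ : MemQ Ω K pT
  momentum : ∀ v : E d → E d, MemV Ω K v →
    formA Ω yT v + formB Ω v pT = ∫ x in Ω, inner ℝ (f x) (v x)
  incompressible : ∀ q : E d → ℝ, MemQ Ω K q → formB Ω yT q = 0

/-! ### The local error indicator -/

/-- `ν` is the unit normal on the side `S` of the simplex `T` that points towards `T`. -/
def IsUnitNormal (S T : Finset (E d)) (ν : E d) : Prop :=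
  ‖ν‖ = 1 ∧ (∀ a ∈ S, ∀ b ∈ S, inner ℝ ν (a - b) = 0) ∧
    ∀ a ∈ S, ∀ v ∈ T, v ∉ S → 0 < inner ℝ ν (v - a)

/-- The jump `⟦∇w · ν⟧ = ∇w|_{T₁} ν₁ + ∇w|_{T₂} ν₂` at points of a side shared by `T₁` and `T₂`;
`∇w|_{T}` is the (one-sided) derivative of `w` within the closed simplex. -/
def jump (w : E d → E d) (T₁ T₂ : Finset (E d)) (ν₁ ν₂ : E d) (x : E d) : E d :=
  fderivWithin ℝ w (cell T₁) x ν₁ + fderivWithin ℝ w (cell T₂) x ν₂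

/-- `‖⟦∇w · ν⟧‖_{L^∞(∂T ∖ ∂Ω)}`: the maximum, over the internal sides `S` of `T`, of the
`L^∞(S)`-norm with respect to surface measure. The other element `T'` at `S` and both normals
are uniquely determined, so that the remaining suprema only name them. -/
def jumpNorm (K : Geometry.SimplicialComplex ℝ (E d)) (w : E d → E d) (T : Finset (E d)) :
    ℝ≥0∞ :=
  ⨆ (S : Finset (E d)) (_ : S ∈ sidesOf K T)
    (T' : Finset (E d)) (_ : T' ∈ K.facets ∧ T' ≠ T ∧ S ⊆ T')
    (ν : E d) (_ : IsUnitNormal S T ν) (ν' : E d) (_ : IsUnitNormal S T' ν'),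
    eLpNorm (jump w T T' ν ν') ∞
      ((Measure.hausdorffMeasure ((d : ℝ) - 1)).restrict (cell S))

/-- The local error indicator
`h_T² ‖f + Δ yT - ∇ pT‖_{L^∞(T)} + (h_T/2) ‖⟦∇ yT · ν⟧‖_{L^∞(∂T ∖ ∂Ω)} + h_T ‖div yT‖_{L^∞(T)}`,
with elementwise classical derivatives of the piecewise polynomials `yT`, `pT`. -/
def indicator (K : Geometry.SimplicialComplex ℝ (E d)) (f yT : E d → E d) (pT : E d → ℝ)
    (T : Finset (E d)) : ℝ≥0∞ :=
  ENNReal.ofReal (size T ^ 2) *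
      eLpNorm (fun x => f x + Laplacian.laplacian yT x - gradient pT x) ∞
        (volume.restrict (cell T)) +
    ENNReal.ofReal (size T / 2) * jumpNorm K yT T +
    ENNReal.ofReal (size T) *
      eLpNorm (fun x => ∑ i : Fin d, gradient (fun z => yT z i) x i) ∞
        (volume.restrict (cell T))

/-! ### Data oscillation -/

/-- Coefficients `(c, L)` for which the vector field `x ↦ L x + c` is square integrable on `s`
(all of them if `s` is bounded). -/
def affineCoeffs (s : Set (E d)) : Submodule ℝ (E d × (E d →ₗ[ℝ] E d)) where
  carrier := {A | MemLp (fun x => A.2 x + A.1) 2 (volume.restrict s)}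
  zero_mem' := by simp
  add_mem' := by
    intro A B hA hB
    refine (MemLp.add hA hB).congr_norm ?_ ?_
    · exact (by
        have : Continuous fun x => (A + B).2 x + (A + B).1 :=
          (LinearMap.continuous_of_finiteDimensional _).add continuous_const
        exact this.aestronglyMeasurable)
    · refine Filter.Eventually.of_forall fun x => ?_
      simp only [Pi.add_apply, Prod.snd_add, Prod.fst_add, LinearMap.add_apply]
      congr 1
      abel
  smul_mem' := by
    intro c A hA
    have h := MemLp.const_smul hA c
    simpa [Pi.smul_def, smul_add] using h

theorem affineCoeffs_memLp {s : Set (E d)} (A : affineCoeffs s) :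
    MemLp (fun x => A.1.2 x + A.1.1) 2 (volume.restrict s) := A.2

/-- The vector field `x ↦ L x + c` as an element of `L²(s)`. -/
def affineToL2 (s : Set (E d)) : affineCoeffs s →ₗ[ℝ] Lp (E d) 2 (volume.restrict s) where
  toFun A := (affineCoeffs_memLp A).toLp
  map_add' A B := by
    rw [← MemLp.toLp_add (affineCoeffs_memLp A) (affineCoeffs_memLp B)]
    refine MemLp.toLp_congr _ _ (Filter.Eventually.of_forall fun x => ?_)
    simp only [Pi.add_apply, Submodule.coe_add, Prod.snd_add, Prod.fst_add, LinearMap.add_apply]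
    abel
  map_smul' c A := by
    rw [RingHom.id_apply, ← MemLp.toLp_const_smul c (affineCoeffs_memLp A)]
    refine MemLp.toLp_congr _ _ (Filter.Eventually.of_forall fun x => ?_)
    simp [smul_add]

/-- The space `P_1(s)^d` of affine vector fields as a (finite-dimensional) subspace of `L²(s)^d`. -/
def affineL2 (s : Set (E d)) : Submodule ℝ (Lp (E d) 2 (volume.restrict s)) :=
  LinearMap.range (affineToL2 s)

instance (s : Set (E d)) : FiniteDimensional ℝ (affineL2 s) :=
  inferInstanceAs (FiniteDimensional ℝ (LinearMap.range (affineToL2 s)))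

open Classical in
/-- The restriction to `s` of the `L²`-orthogonal projection of `f` onto the (discontinuous)
piecewise linear vector fields: the `L²(s)`-orthogonal projection of `f` onto `P_1(s)^d`. -/
def proj (s : Set (E d)) (f : E d → E d) : E d → E d :=
  if hf : MemLp f 2 (volume.restrict s) then
    ((affineL2 s).starProjection (hf.toLp f) : Lp (E d) 2 (volume.restrict s))
  else 0

/-- `osc_∞(f; 𝒩_T) = max_{T' ⊆ 𝒩_T} h_{T'}² ‖f - Π f‖_{L^∞(T')}`. -/
def osc (K : Geometry.SimplicialComplex ℝ (E d)) (f : E d → E d) (T : Finset (E d)) : ℝ≥0∞ :=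
  ⨆ T' ∈ patchElements K T,
    ENNReal.ofReal (size T' ^ 2) *
      eLpNorm (fun x => f x - proj (cell T') f x) ∞ (volume.restrict (cell T'))

end TaylorHood

end

/-!
The indicator is bounded by the error by testing the error equations with smooth radial bump
functions `φ`. Only the pointwise size of the error may enter, so all derivatives are moved onto
the test function: by two integrations by parts (`IsStokesSolution.very_weak`,
`IsStokesSolution.very_weak_incompressible`) the weak solution satisfies

`∫ fᵢ φ = - ∫ yᵢ Δφ - ∫ p ∂ᵢφ` and `∑ᵢ ∫ yᵢ ∂ᵢφ = 0`

for every test function. If `φ` is supported in a ball on which `(yT, pT)` is polynomial on either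
side of a hyperplane `{t = 0}`, `t = ν · (x - s)`, then the difference of the two velocity
polynomials factors as `t (a + w · (x - s))` (`quad_eq_of_vanish`), that of the pressures is a
multiple of `t`, and the corresponding expression for `(yT, pT)` can be computed from the
distributional derivative of `t₊` alone (`integral_posPart_mul_fderiv`). The result is
`IsStokesSolution.residual_identity`: the integral of the element residual against `φ`, plus the
jump `a` of the normal derivative at `s` times the integral of `φ` over the hyperplane, equals
`- ∫ (yᵢ - yTᵢ) Δφ - ∫ (p - pT) ∂ᵢφ`. For a bump of radius `ρ`, the last two integrals are of size
`ρ ^ (d - 2) ‖y - yT‖_∞` and `ρ ^ (d - 1) ‖p - pT‖_∞`.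

No reference element is needed. After `f` is replaced by its projection, the element residual, like
the divergence and the jump, is affine. An affine function has the mean value property for radial
weights (`integral_affine_mul_bump`), which bounds it on a ball (on a disc in the side, for the
jump), and the bound extends to the element (to the side) because its diameter is at most a
constant times the radius (`abs_affine_le`). For the residual and the divergence the balls lie in
the ball inscribed in the element. For the jump they are centred on the side near its centroid:
barycentric coordinates have slope at most `1 / (2r)` when the element contains a ball of radius `r`
(`IsElement.exists_barycentric`), so that near the centroid the element coincides with a half-space
(`IsElement.halfBall_subset`) and the two elements at the side fill a ball of radius comparable with
`h_T`.
-/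

noncomputable section

namespace TaylorHood

open scoped RealInnerProductSpace

variable {d : ℕ}

/-! ### Smooth functions with compact support -/

/-- The `i`-th vector of the standard basis of `ℝ^d`. -/
abbrev stdVec (i : Fin d) : E d := EuclideanSpace.single i 1

/-- The Laplacian of a scalar function, as the sum of its pure second partial derivatives. -/
def lap (φ : E d → ℝ) (x : E d) : ℝ :=
  ∑ i : Fin d, fderiv ℝ (fun z => fderiv ℝ φ z (stdVec i)) x (stdVec i)

theorem gradient_apply (φ : E d → ℝ) (x : E d) (i : Fin d) :
    gradient φ x i = fderiv ℝ φ x (stdVec i) := by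
  have h : ⟪gradient φ x, stdVec i⟫ = fderiv ℝ φ x (stdVec i) := by
    simp [gradient, InnerProductSpace.toDual_symm_apply]
  rw [← h, EuclideanSpace.inner_single_right]; simp

theorem inner_stdVec (w : E d) (i : Fin d) : ⟪w, stdVec i⟫ = w i := by
  rw [EuclideanSpace.inner_single_right]; simp

theorem sum_mul_stdVec (v w : E d) : ∑ i, v i * w i = ⟪v, w⟫ := by
  simp [PiLp.inner_apply, mul_comm]

theorem sum_mul_clm (L : E d →L[ℝ] ℝ) (v : E d) : ∑ i, v i * L (stdVec i) = L v := by
  have h : v = ∑ i, v i • stdVec i := by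
    ext j; simp [stdVec, Finset.sum_apply, Pi.single_apply]
  conv_rhs => rw [h]
  simp [map_sum]

/-- `φ` is smooth with compact support in the whole space. -/
def IsCc (φ : E d → ℝ) : Prop := ContDiff ℝ ∞ φ ∧ HasCompactSupport φ

namespace IsCc

variable {φ ψ : E d → ℝ}

theorem continuous (h : IsCc φ) : Continuous φ := h.1.continuous

theorem differentiable (h : IsCc φ) : Differentiable ℝ φ := h.1.differentiable (by simp)

theorem integrable (h : IsCc φ) : Integrable φ := h.continuous.integrable_of_hasCompactSupport h.2

theorem fderiv_apply (h : IsCc φ) (w : E d) : IsCc fun x => fderiv ℝ φ x w :=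
  ⟨(h.1.fderiv_right (m := ∞) (by simp)).clm_apply contDiff_const,
    h.2.fderiv_apply (𝕜 := ℝ) (v := w)⟩

theorem mul_left (h : IsCc φ) {u : E d → ℝ} (hu : ContDiff ℝ ∞ u) : IsCc fun x => u x * φ x :=
  ⟨hu.mul h.1, h.2.mul_left⟩

theorem integrable_mul (h : IsCc φ) {u : E d → ℝ} (hu : Continuous u) :
    Integrable fun x => u x * φ x :=
  (hu.mul h.continuous).integrable_of_hasCompactSupport h.2.mul_left

theorem sum {ι : Type*} (s : Finset ι) {F : ι → E d → ℝ} (h : ∀ i ∈ s, IsCc (F i)) :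
    IsCc fun x => ∑ i ∈ s, F i x := by
  classical
  induction s using Finset.induction_on with
  | empty =>
    simp only [Finset.sum_empty]
    exact ⟨contDiff_const, HasCompactSupport.zero⟩
  | insert a s ha ih =>
    simp only [Finset.sum_insert ha]
    have h1 := h a (Finset.mem_insert_self _ _)
    have h2 := ih fun i hi => h i (Finset.mem_insert_of_mem hi)
    exact ⟨h1.1.add h2.1, h1.2.add h2.2⟩

theorem lap (h : IsCc φ) : IsCc (lap φ) :=
  IsCc.sum _ fun i _ => (h.fderiv_apply (stdVec i)).fderiv_apply (stdVec i)

theorem lipschitz (h : IsCc φ) : ∃ C, LipschitzWith C φ :=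
  h.1.lipschitzWith_of_hasCompactSupport h.2 (by simp)

/-- Integration by parts on the whole space. -/
theorem integral_mul_fderiv (h : IsCc φ) {u : E d → ℝ} (hu : ContDiff ℝ ∞ u) (w : E d) :
    ∫ x, u x * fderiv ℝ φ x w = - ∫ x, fderiv ℝ u x w * φ x := by
  refine integral_mul_fderiv_eq_neg_fderiv_mul_of_integrable ?_ ?_ ?_ ?_ ?_
  · exact h.integrable_mul ((hu.continuous_fderiv (by simp)).clm_apply continuous_const)
  · exact (h.fderiv_apply w).integrable_mul hu.continuous
  · exact h.integrable_mul hu.continuous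
  · exact fun x _ => hu.differentiable (by simp) x
  · exact fun x _ => h.differentiable x

end IsCc

/-! ### Integration by parts in a half-space -/

theorem volume_hyperplane {ν : E d} (hν : ν ≠ 0) (s : E d) :
    volume {x : E d | ⟪ν, x - s⟫ = 0} = 0 := by
  have hne : (ℝ ∙ ν)ᗮ ≠ ⊤ := by
    intro h
    have : ν ∈ (ℝ ∙ ν)ᗮ := by rw [h]; trivial
    rw [Submodule.mem_orthogonal_singleton_iff_inner_right] at this
    exact hν (inner_self_eq_zero.1 this)
  have h0 := Measure.addHaar_submodule (volume : Measure (E d)) _ hne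
  have : {x : E d | ⟪ν, x - s⟫ = 0} = (fun x => x + -s) ⁻¹' ((ℝ ∙ ν)ᗮ : Set (E d)) := by
    ext x
    simp [Submodule.mem_orthogonal_singleton_iff_inner_right, sub_eq_add_neg]
  rw [this, measure_preimage_add_right, h0]

/-- The open half-space `{x | 0 < ν · (x - s)}`. -/
def halfSpace (ν s : E d) : Set (E d) := {x | 0 < ⟪ν, x - s⟫}

theorem measurableSet_halfSpace (ν s : E d) : MeasurableSet (halfSpace ν s) :=
  (isOpen_lt continuous_const (by fun_prop)).measurableSet

/-- The distributional derivative of the positive part of `x ↦ ν · (x - s)` is `ν` times the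
characteristic function of the half-space. -/
theorem integral_posPart_mul_fderiv {ν : E d} (hν : ν ≠ 0) (s w : E d) {g : E d → ℝ}
    (hg : IsCc g) :
    ∫ x, max ⟪ν, x - s⟫ 0 * fderiv ℝ g x w = - (⟪ν, w⟫ * ∫ x in halfSpace ν s, g x) := by
  obtain ⟨D, hD⟩ := hg.lipschitz
  have hL : LipschitzWith ‖ν‖₊ fun x : E d => ⟪ν, x - s⟫ := by
    refine LipschitzWith.of_dist_le_mul fun x y => ?_
    rw [Real.dist_eq, ← inner_sub_right, sub_sub_sub_cancel_right, dist_eq_norm]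
    exact abs_real_inner_le_norm _ _
  have hF : LipschitzWith ‖ν‖₊ fun x : E d => max ⟪ν, x - s⟫ 0 := hL.max_const 0
  have key := hF.integral_lineDeriv_mul_eq (μ := volume) hD hg.2 w
  have hline : ∀ x, lineDeriv ℝ g x (-w) = - fderiv ℝ g x w := fun x => by
    rw [(hg.differentiable x).lineDeriv_eq_fderiv]; simp
  have hcont : Continuous fun x : E d => ⟪ν, x - s⟫ := by fun_prop
  have hae : ∀ᵐ x : E d, lineDeriv ℝ (fun x : E d => max ⟪ν, x - s⟫ 0) x w * g x =
      ⟪ν, w⟫ * (halfSpace ν s).indicator g x := by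
    have : ∀ᵐ x : E d, ⟪ν, x - s⟫ ≠ 0 := by
      rw [ae_iff]; simpa using volume_hyperplane hν s
    filter_upwards [this] with x hx
    rcases lt_or_gt_of_ne hx with h | h
    · have h1 : (fun x : E d => max ⟪ν, x - s⟫ 0) =ᶠ[nhds x] fun _ => (0 : ℝ) := by
        filter_upwards [hcont.continuousAt.eventually_lt_const h] with z hz
        exact max_eq_right hz.le
      rw [h1.lineDeriv_eq]
      have : x ∉ halfSpace ν s := fun h' => lt_asymm h h'
      simp [indicator_of_notMem this, lineDeriv]
    · have h1 : (fun x : E d => max ⟪ν, x - s⟫ 0) =ᶠ[nhds x] fun x => ⟪ν, x - s⟫ := by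
        filter_upwards [hcont.continuousAt.eventually_const_lt h] with z hz
        exact max_eq_left hz.le
      have h2 : HasFDerivAt (fun x : E d => ⟪ν, x - s⟫) (innerSL ℝ ν) x := by
        have := (innerSL ℝ ν).hasFDerivAt (x := x - s)
        exact this.comp x ((hasFDerivAt_id x).sub_const s)
      rw [h1.lineDeriv_eq, (h2.hasLineDerivAt w).lineDeriv]
      have : x ∈ halfSpace ν s := h
      simp [indicator_of_mem this]
  rw [integral_congr_ae hae, integral_const_mul,
    integral_indicator (measurableSet_halfSpace ν s)] at key
  rw [key, ← integral_neg]
  refine integral_congr_ae (Filter.Eventually.of_forall fun x => ?_)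
  simp only [hline]; ring

/-! ### Radial bump functions -/

/-- A smooth radial bump supported in the closed unit ball and decreasing in `‖x‖`. -/
def profile (x : E d) : ℝ := expNegInvGlue (1 - ‖x‖ ^ 2)

theorem profile_contDiff : ContDiff ℝ ∞ (profile : E d → ℝ) :=
  expNegInvGlue.contDiff.comp (contDiff_const.sub (contDiff_norm_sq ℝ))

theorem profile_nonneg (x : E d) : 0 ≤ profile x := expNegInvGlue.nonneg _

theorem profile_eq_zero {x : E d} (hx : 1 ≤ ‖x‖) : profile x = 0 :=
  expNegInvGlue.zero_of_nonpos (by nlinarith)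

theorem profile_neg (x : E d) : profile (-x) = profile x := by simp [profile]

theorem profile_isCc : IsCc (profile : E d → ℝ) := by
  refine ⟨profile_contDiff, HasCompactSupport.intro (isCompact_closedBall (0 : E d) 1) ?_⟩
  intro x hx
  exact profile_eq_zero (by simpa using (not_le.1 (fun h => hx (by simpa using h))).le)

theorem fderiv_profile (x w : E d) :
    fderiv ℝ profile x w = - (2 * deriv expNegInvGlue (1 - ‖x‖ ^ 2) * ⟪x, w⟫) := by
  have h1 : HasFDerivAt (fun x : E d => 1 - ‖x‖ ^ 2) (-(2 • (innerSL ℝ x))) x :=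
    ((hasStrictFDerivAt_norm_sq x).hasFDerivAt).const_sub 1
  have h2 : HasDerivAt expNegInvGlue (deriv expNegInvGlue (1 - ‖x‖ ^ 2)) (1 - ‖x‖ ^ 2) :=
    ((expNegInvGlue.contDiff (n := 1)).differentiable (by simp) _).hasDerivAt
  have h3 := h2.comp_hasFDerivAt x h1
  have : HasFDerivAt profile _ x := h3
  rw [this.fderiv]
  simp; ring

/-- The bump function with centre `s` and radius `ρ`. -/
def bump (s : E d) (ρ : ℝ) (x : E d) : ℝ := profile (ρ⁻¹ • (x - s))

section bump

variable (s : E d) {ρ : ℝ}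

theorem bump_contDiff : ContDiff ℝ ∞ (bump s ρ) :=
  profile_contDiff.comp ((contDiff_id.sub contDiff_const).const_smul ρ⁻¹)

theorem bump_nonneg (x : E d) : 0 ≤ bump s ρ x := profile_nonneg _

theorem bump_tsupport (hρ : 0 < ρ) : tsupport (bump s ρ) ⊆ Metric.closedBall s ρ := by
  refine closure_minimal ?_ Metric.isClosed_closedBall
  intro x hx
  by_contra h
  refine hx (profile_eq_zero ?_)
  rw [Metric.mem_closedBall, not_le, dist_eq_norm] at h
  rw [norm_smul, norm_inv, Real.norm_of_nonneg hρ.le, ← div_eq_inv_mul, one_le_div hρ]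
  exact h.le

theorem bump_isCc (hρ : 0 < ρ) : IsCc (bump s ρ) :=
  ⟨bump_contDiff s, (isCompact_closedBall s ρ).of_isClosed_subset (isClosed_tsupport _)
    (bump_tsupport s hρ)⟩

theorem fderiv_comp_scale (u : E d → ℝ) (hu : Differentiable ℝ u) (x w : E d) :
    fderiv ℝ (fun x => u (ρ⁻¹ • (x - s))) x w = ρ⁻¹ * fderiv ℝ u (ρ⁻¹ • (x - s)) w := by
  have h1 : HasFDerivAt (fun x : E d => ρ⁻¹ • (x - s)) (ρ⁻¹ • ContinuousLinearMap.id ℝ (E d)) x :=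
    ((hasFDerivAt_id x).sub_const s).const_smul ρ⁻¹
  have h2 := (hu (ρ⁻¹ • (x - s))).hasFDerivAt.comp x h1
  have : HasFDerivAt (fun x => u (ρ⁻¹ • (x - s))) _ x := h2
  rw [this.fderiv]; simp

theorem fderiv_bump (x w : E d) :
    fderiv ℝ (bump s ρ) x w = ρ⁻¹ * fderiv ℝ profile (ρ⁻¹ • (x - s)) w :=
  fderiv_comp_scale s profile profile_isCc.differentiable x w

theorem lap_bump (x : E d) : lap (bump s ρ) x = ρ⁻¹ ^ 2 * lap profile (ρ⁻¹ • (x - s)) := by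
  unfold lap
  rw [Finset.mul_sum]
  refine Finset.sum_congr rfl fun i _ => ?_
  have h := fderiv_comp_scale s (ρ := ρ) (fun z => fderiv ℝ profile z (stdVec i))
    (profile_isCc.fderiv_apply _).differentiable x (stdVec i)
  have h1 : (fun z => fderiv ℝ (bump s ρ) z (stdVec i)) =
      fun z => ρ⁻¹ * fderiv ℝ profile (ρ⁻¹ • (z - s)) (stdVec i) :=
    funext fun z => fderiv_bump s z _
  rw [h1, fderiv_const_mul]
  · simp only [smul_apply, smul_eq_mul]
    rw [h]; ring
  · exact ((profile_isCc.fderiv_apply (stdVec i)).differentiable _).comp x (by fun_prop)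

/-- Radial functions have radial gradients. -/
theorem fderiv_bump_radial (x v w : E d) :
    ⟪w, x - s⟫ * fderiv ℝ (bump s ρ) x v = ⟪v, x - s⟫ * fderiv ℝ (bump s ρ) x w := by
  simp only [fderiv_bump, fderiv_profile, inner_smul_left, real_inner_comm (x - s)]
  simp; ring

theorem integral_comp_scale (hρ : 0 < ρ) (G : E d → ℝ) :
    ∫ x, G (ρ⁻¹ • (x - s)) = ρ ^ d * ∫ x, G x := by
  rw [integral_sub_right_eq_self (fun x => G (ρ⁻¹ • x)) s, Measure.integral_comp_inv_smul]
  simp [abs_of_pos hρ]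

theorem integral_bump (hρ : 0 < ρ) : ∫ x, bump s ρ x = ρ ^ d * ∫ x : E d, profile x :=
  integral_comp_scale s hρ _

theorem integral_abs_fderiv_bump (hρ : 0 < ρ) (w : E d) :
    ∫ x, |fderiv ℝ (bump s ρ) x w| = ρ ^ d * ρ⁻¹ * ∫ x : E d, |fderiv ℝ profile x w| := by
  simp_rw [fderiv_bump, abs_mul, abs_of_pos (inv_pos.2 hρ)]
  rw [integral_const_mul, integral_comp_scale s hρ fun x => |fderiv ℝ profile x w|]; ring

theorem integral_abs_lap_bump (hρ : 0 < ρ) :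
    ∫ x, |lap (bump s ρ) x| = ρ ^ d * ρ⁻¹ ^ 2 * ∫ x : E d, |lap profile x| := by
  simp_rw [lap_bump, abs_mul, abs_of_nonneg (sq_nonneg ρ⁻¹)]
  rw [integral_const_mul, integral_comp_scale s hρ fun x => |lap profile x|]; ring

/-- Affine functions have the mean value property for radial weights. -/
theorem integral_affine_mul_bump (hρ : 0 < ρ) (A : ℝ) (ℓ : E d →L[ℝ] ℝ) :
    ∫ x, (A + ℓ (x - s)) * bump s ρ x = A * ∫ x, bump s ρ x := by
  have h1 : Integrable fun x => ℓ (x - s) * bump s ρ x :=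
    (bump_isCc s hρ).integrable_mul (by fun_prop)
  have h0 : ∫ x, ℓ (x - s) * bump s ρ x = 0 := by
    have e1 : ∫ x, ℓ (x - s) * bump s ρ x = ∫ x, ℓ x * profile (ρ⁻¹ • x) :=
      integral_sub_right_eq_self (fun x => ℓ x * profile (ρ⁻¹ • x)) s
    have e2 : ∫ x, ℓ x * profile (ρ⁻¹ • x) = - ∫ x, ℓ x * profile (ρ⁻¹ • x) := by
      conv_lhs => rw [← integral_neg_eq_self]
      rw [← integral_neg]
      simp [profile_neg]
    rw [e1]; linarith
  simp_rw [add_mul]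
  rw [integral_add ((bump_isCc s hρ).integrable.const_mul A) h1, integral_const_mul, h0, add_zero]

end bump

/-- The integral of `-∂_ν` of the unit bump over the half-space `{ν · x > 0}`, that is, the
integral of the bump over the hyperplane `{ν · x = 0}`. -/
def sideMass (ν : E d) : ℝ := - ∫ x in halfSpace ν 0, fderiv ℝ profile x ν

theorem deriv_expNegInvGlue_nonneg (r : ℝ) : 0 ≤ deriv expNegInvGlue r :=
  expNegInvGlue.monotone.deriv_nonneg

/-- `-∂_ν` of the bump is nonnegative in the half-space, and not identically zero as the bump drops
from a positive value at `0` to zero at `ν`. -/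
theorem sideMass_pos {ν : E d} (hν : ‖ν‖ = 1) : 0 < sideMass ν := by
  have hcont : Continuous fun x : E d => fderiv ℝ profile x ν :=
    (profile_isCc.fderiv_apply ν).continuous
  unfold sideMass
  rw [← integral_neg, integral_pos_iff_support_of_nonneg_ae]
  · by_contra hcon
    have h0 : volume.restrict (halfSpace ν 0)
        (Function.support fun x => -fderiv ℝ profile x ν) = 0 := by simpa using hcon
    have hopen : IsOpen (Function.support fun x : E d => -fderiv ℝ profile x ν) :=
      hcont.neg.isOpen_support
    rw [Measure.restrict_apply hopen.measurableSet] at h0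
    have hhalf : IsOpen (halfSpace ν (0 : E d)) := isOpen_lt continuous_const (by fun_prop)
    -- Otherwise `∂_ν` of the bump vanishes on the open half-space, hence on the line `ℝ ν`.
    have hempty := ((hopen.inter hhalf).measure_eq_zero_iff (μ := volume)).1 h0
    have hz : ∀ t : ℝ, fderiv ℝ profile (t • ν) ν = 0 := by
      have hpos : ∀ t : ℝ, 0 < t → fderiv ℝ profile (t • ν) ν = 0 := by
        intro t ht
        by_contra hne
        have : t • ν ∈ (Function.support fun x : E d => -fderiv ℝ profile x ν) ∩ halfSpace ν 0 := by
          refine ⟨by simpa using hne, ?_⟩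
          simp [halfSpace, inner_smul_right, hν, ht]
        rw [hempty] at this; exact this
      intro t
      rcases lt_trichotomy t 0 with h | h | h
      · have := hpos (-t) (by linarith)
        rw [fderiv_profile] at this ⊢
        simp only [neg_smul, norm_neg, inner_neg_left] at this
        linarith
      · rw [fderiv_profile, h]; simp
      · exact hpos t h
    have hconst : profile (1 • ν) = profile ((0 : ℝ) • ν) := by
      have hd : ∀ t : ℝ, HasDerivAt (fun t : ℝ => profile (t • ν)) 0 t := by
        intro t
        have h1 := (profile_isCc.differentiable (t • ν)).hasFDerivAt.comp_hasDerivAt t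
          ((hasDerivAt_id t).smul_const ν)
        simp only [id, one_smul, hz t] at h1
        exact h1
      have := is_const_of_deriv_eq_zero (fun t => (hd t).differentiableAt)
        (fun t => (hd t).deriv) 1 0
      simpa using this
    rw [one_smul, zero_smul, profile_eq_zero hν.ge] at hconst
    have : 0 < profile (0 : E d) := expNegInvGlue.pos_of_pos (by simp)
    linarith
  · refine (ae_restrict_iff' (measurableSet_halfSpace _ _)).2 (Filter.Eventually.of_forall ?_)
    intro x hx
    have hx' : 0 < ⟪ν, x⟫ := by simpa [halfSpace] using hx
    simp only [Pi.zero_apply]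
    rw [fderiv_profile, real_inner_comm]
    have := mul_nonneg (deriv_expNegInvGlue_nonneg (1 - ‖x‖ ^ 2)) hx'.le
    nlinarith
  · exact (profile_isCc.fderiv_apply ν).integrable.neg.integrableOn

/-- By rotation invariance, the mass on a hyperplane does not depend on its direction. -/
theorem sideMass_eq {ν μ : E d} (hν : ‖ν‖ = 1) (hμ : ‖μ‖ = 1) : sideMass ν = sideMass μ := by
  set Φ : E d ≃ₗᵢ[ℝ] E d := (ℝ ∙ (ν - μ))ᗮ.reflection with hΦ
  have hmap : Φ ν = μ := Submodule.reflection_sub (hν.trans hμ.symm)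
  have hpre : Φ ⁻¹' halfSpace μ 0 = halfSpace ν 0 := by
    ext x
    simp only [halfSpace, mem_preimage, mem_ofPred_eq, sub_zero, ← hmap]
    rw [Φ.inner_map_map]
  unfold sideMass
  rw [← Φ.measurePreserving.setIntegral_preimage_emb
    Φ.toHomeomorph.measurableEmbedding (fun x => fderiv ℝ profile x μ) (halfSpace μ 0), hpre]
  congr 2 with x
  rw [fderiv_profile, fderiv_profile, Φ.norm_map, ← hmap, Φ.inner_map_map]

section sideIntegrals

variable {ν : E d} (s : E d) {ρ : ℝ}

theorem integral_halfSpace_fderiv_bump (hρ : 0 < ρ) :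
    ∫ x in halfSpace ν s, fderiv ℝ (bump s ρ) x ν = - (ρ ^ d * ρ⁻¹ * sideMass ν) := by
  have h1 : ∀ x, (halfSpace ν s).indicator (fun x => fderiv ℝ (bump s ρ) x ν) x =
      ρ⁻¹ * (halfSpace ν 0).indicator (fun x => fderiv ℝ profile x ν) (ρ⁻¹ • (x - s)) := by
    intro x
    have hiff : ρ⁻¹ • (x - s) ∈ halfSpace ν 0 ↔ x ∈ halfSpace ν s := by
      simp [halfSpace, inner_smul_right, hρ]
    by_cases hx : x ∈ halfSpace ν s
    · rw [indicator_of_mem hx, indicator_of_mem (hiff.2 hx), fderiv_bump]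
    · rw [indicator_of_notMem hx, indicator_of_notMem (mt hiff.1 hx), mul_zero]
  rw [← integral_indicator (measurableSet_halfSpace ν s), integral_congr_ae
    (Filter.Eventually.of_forall h1), integral_const_mul, integral_comp_scale s hρ,
    integral_indicator (measurableSet_halfSpace ν 0), sideMass]
  ring

/-- The Laplacian of `t₊`, with `t = ν · (x - s)`, is the surface measure of the hyperplane. -/
theorem integral_posPart_mul_lap_bump (hν : ‖ν‖ = 1) (hρ : 0 < ρ) :
    ∫ x, max ⟪ν, x - s⟫ 0 * lap (bump s ρ) x = ρ ^ d * ρ⁻¹ * sideMass ν := by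
  have hν0 : ν ≠ 0 := by rintro rfl; simp at hν
  have hφ := bump_isCc s hρ
  have hc : Continuous fun x : E d => max ⟪ν, x - s⟫ 0 := by fun_prop
  simp_rw [lap, Finset.mul_sum]
  rw [integral_finsetSum _ fun i _ =>
    ((hφ.fderiv_apply (stdVec i)).fderiv_apply (stdVec i)).integrable_mul hc]
  simp_rw [integral_posPart_mul_fderiv hν0 s _ (hφ.fderiv_apply _), inner_stdVec]
  rw [Finset.sum_neg_distrib]
  simp_rw [← integral_const_mul]
  rw [← integral_finsetSum _ fun i _ =>
    ((hφ.fderiv_apply (stdVec i)).integrable.const_mul _).integrableOn]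
  simp_rw [sum_mul_clm]
  rw [integral_halfSpace_fderiv_bump s hρ, neg_neg]

/-- The Laplacian of `t₊ (w · (x - s))` is `2 ν · w` in the half-space; the contribution of the
hyperplane vanishes against a radial bump. -/
theorem integral_posPart_mul_inner_mul_lap_bump (hν : ν ≠ 0) (w : E d) (hρ : 0 < ρ) :
    ∫ x, max ⟪ν, x - s⟫ 0 * (⟪w, x - s⟫ * lap (bump s ρ) x) =
      2 * ⟪ν, w⟫ * ∫ x in halfSpace ν s, bump s ρ x := by
  have hφ := bump_isCc s hρ
  have hc : Continuous fun x : E d => max ⟪ν, x - s⟫ 0 := by fun_prop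
  have hw : ContDiff ℝ ∞ fun x : E d => ⟪w, x - s⟫ :=
    contDiff_const.inner ℝ (contDiff_id.sub contDiff_const)
  have hg : ∀ i : Fin d, IsCc fun x => ⟪w, x - s⟫ * fderiv ℝ (bump s ρ) x (stdVec i) :=
    fun i => (hφ.fderiv_apply _).mul_left hw
  have hd : ∀ x v, fderiv ℝ (fun x : E d => ⟪w, x - s⟫) x v = ⟪w, v⟫ := by
    intro x v
    have h2 : HasFDerivAt (fun x : E d => ⟪w, x - s⟫) (innerSL ℝ w) x := by
      have := (innerSL ℝ w).hasFDerivAt (x := x - s)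
      exact this.comp x ((hasFDerivAt_id x).sub_const s)
    rw [h2.fderiv]; simp
  -- Write `(w · (x - s)) Δφ` as the divergence of `(w · (x - s)) ∇φ` minus `∂_w φ`.
  have hexp : ∀ x, max ⟪ν, x - s⟫ 0 * (⟪w, x - s⟫ * lap (bump s ρ) x) =
      (∑ i, max ⟪ν, x - s⟫ 0 * fderiv ℝ
        (fun x => ⟪w, x - s⟫ * fderiv ℝ (bump s ρ) x (stdVec i)) x (stdVec i)) -
      max ⟪ν, x - s⟫ 0 * fderiv ℝ (bump s ρ) x w := by
    intro x
    have : ∀ i : Fin d, fderiv ℝ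
        (fun x => ⟪w, x - s⟫ * fderiv ℝ (bump s ρ) x (stdVec i)) x (stdVec i) =
        ⟪w, x - s⟫ * fderiv ℝ (fun z => fderiv ℝ (bump s ρ) z (stdVec i)) x (stdVec i) +
        w i * fderiv ℝ (bump s ρ) x (stdVec i) := by
      intro i
      rw [fderiv_fun_mul (hw.differentiable (by simp) x) ((hφ.fderiv_apply _).differentiable x)]
      simp only [add_apply, smul_apply, smul_eq_mul, hd,
        inner_stdVec]
      ring
    simp_rw [this]
    rw [← Finset.mul_sum, Finset.sum_add_distrib, sum_mul_clm, ← Finset.mul_sum, ← lap]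
    ring
  have hI : ∀ i : Fin d, Integrable fun x => max ⟪ν, x - s⟫ 0 * fderiv ℝ
        (fun x => ⟪w, x - s⟫ * fderiv ℝ (bump s ρ) x (stdVec i)) x (stdVec i) :=
    fun i => ((hg i).fderiv_apply _).integrable_mul hc
  simp_rw [hexp]
  rw [integral_sub (integrable_finsetSum _ fun i _ => hI i)
    ((hφ.fderiv_apply w).integrable_mul hc), integral_finsetSum _ fun i _ => hI i]
  simp_rw [fun i : Fin d => integral_posPart_mul_fderiv hν s (stdVec i) (hg i), inner_stdVec]
  rw [integral_posPart_mul_fderiv hν s w hφ, Finset.sum_neg_distrib]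
  simp_rw [← integral_const_mul]
  rw [← integral_finsetSum _ fun i _ => ((hg i).integrable.const_mul _).integrableOn]
  have e1 : ∀ x, ∑ i, ν i * (⟪w, x - s⟫ * fderiv ℝ (bump s ρ) x (stdVec i)) =
      ⟪ν, x - s⟫ * fderiv ℝ (bump s ρ) x w := by
    intro x
    rw [← fderiv_bump_radial, ← sum_mul_clm _ ν, Finset.mul_sum]
    exact Finset.sum_congr rfl fun i _ => by ring
  simp_rw [e1]
  have e2 : ∫ x in halfSpace ν s, ⟪ν, x - s⟫ * fderiv ℝ (bump s ρ) x w =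
      ∫ x, max ⟪ν, x - s⟫ 0 * fderiv ℝ (bump s ρ) x w := by
    rw [← integral_indicator (measurableSet_halfSpace ν s)]
    refine integral_congr_ae (Filter.Eventually.of_forall fun x => ?_)
    by_cases hx : x ∈ halfSpace ν s
    · simp only [indicator_of_mem hx, max_eq_left (le_of_lt (show 0 < ⟪ν, x - s⟫ from hx))]
    · simp only [indicator_of_notMem hx, max_eq_right (not_lt.1 (show ¬ 0 < ⟪ν, x - s⟫ from hx)),
        zero_mul]
  rw [e2, integral_posPart_mul_fderiv hν s w hφ]
  simp_rw [integral_const_mul]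
  ring

end sideIntegrals

/-! ### Affine and quadratic functions -/

/-- The quadratic function with value `c`, linear part `ℓ` and (not necessarily symmetric)
bilinear part `B` at the origin. -/
def quad (c : ℝ) (ℓ : E d →L[ℝ] ℝ) (B : E d →L[ℝ] E d →L[ℝ] ℝ) (x : E d) : ℝ := c + ℓ x + B x x

theorem hasFDerivAt_quad (c : ℝ) (ℓ : E d →L[ℝ] ℝ) (B : E d →L[ℝ] E d →L[ℝ] ℝ) (x : E d) :
    HasFDerivAt (quad c ℓ B) (ℓ + (B x + B.flip x)) x := by
  have h1 : HasFDerivAt (fun x => B x x) (B x + B.flip x) x := by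
    have := B.hasFDerivAt_of_bilinear (hasFDerivAt_id x) (hasFDerivAt_id x)
    refine this.congr_fderiv ?_
    ext v; simp
  exact (ℓ.hasFDerivAt.const_add c).add h1

theorem contDiff_quad (c : ℝ) (ℓ : E d →L[ℝ] ℝ) (B : E d →L[ℝ] E d →L[ℝ] ℝ) :
    ContDiff ℝ ∞ (quad c ℓ B) :=
  (contDiff_const.add ℓ.contDiff).add (B.contDiff.clm_apply contDiff_id)

theorem fderiv_quad (c : ℝ) (ℓ : E d →L[ℝ] ℝ) (B : E d →L[ℝ] E d →L[ℝ] ℝ) (x v : E d) :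
    fderiv ℝ (quad c ℓ B) x v = ℓ v + (B x v + B v x) := by
  rw [(hasFDerivAt_quad c ℓ B x).fderiv]; simp

theorem lap_quad (c : ℝ) (ℓ : E d →L[ℝ] ℝ) (B : E d →L[ℝ] E d →L[ℝ] ℝ) (x : E d) :
    lap (quad c ℓ B) x = ∑ i, 2 * B (stdVec i) (stdVec i) := by
  unfold lap
  refine Finset.sum_congr rfl fun i _ => ?_
  simp_rw [fderiv_quad]
  have h : HasFDerivAt (fun z => ℓ (stdVec i) + (B z (stdVec i) + B (stdVec i) z))
      (B.flip (stdVec i) + B (stdVec i)) x :=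
    ((B.flip (stdVec i)).hasFDerivAt.add (B (stdVec i)).hasFDerivAt).const_add _
  rw [h.fderiv]; simp; ring

theorem quad_sub (c c' : ℝ) (ℓ ℓ' : E d →L[ℝ] ℝ) (B B' : E d →L[ℝ] E d →L[ℝ] ℝ) (x : E d) :
    quad c ℓ B x - quad c' ℓ' B' x = quad (c - c') (ℓ - ℓ') (B - B') x := by
  simp [quad]; ring

theorem monomial_degree_le_one (s : Fin d →₀ ℕ) (hs : (s.sum fun _ e => e) ≤ 1) :
    ∃ (c : ℝ) (ℓ : E d →L[ℝ] ℝ), ∀ x : E d, (s.prod fun i e => x i ^ e) = c + ℓ x := by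
  by_cases h0 : s = 0
  · exact ⟨1, 0, by simp [h0]⟩
  · obtain ⟨i, hi⟩ := Finsupp.ne_iff.1 h0
    have hle : Finsupp.single i 1 ≤ s := by
      rw [Finsupp.single_le_iff]; exact Nat.one_le_iff_ne_zero.2 hi
    obtain ⟨t, rfl⟩ := exists_add_of_le hle
    rw [Finsupp.sum_add_index' (by simp) (by simp), Finsupp.sum_single_index rfl] at hs
    have ht : t = 0 := by
      ext j
      by_contra hj
      have : t j ≤ t.sum fun _ e => e :=
        Finset.single_le_sum (f := fun j => t j) (by simp) (Finsupp.mem_support_iff.2 hj)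
      simp only [Finsupp.coe_zero, Pi.zero_apply] at hj
      omega
    refine ⟨0, EuclideanSpace.proj i, fun x => ?_⟩
    simp [ht]

theorem monomial_degree_le_two (s : Fin d →₀ ℕ) (hs : (s.sum fun _ e => e) ≤ 2) :
    ∃ (c : ℝ) (ℓ : E d →L[ℝ] ℝ) (B : E d →L[ℝ] E d →L[ℝ] ℝ),
      ∀ x : E d, (s.prod fun i e => x i ^ e) = quad c ℓ B x := by
  by_cases h0 : s = 0
  · exact ⟨1, 0, 0, by simp [h0, quad]⟩
  · obtain ⟨i, hi⟩ := Finsupp.ne_iff.1 h0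
    have hle : Finsupp.single i 1 ≤ s := by
      rw [Finsupp.single_le_iff]; exact Nat.one_le_iff_ne_zero.2 hi
    obtain ⟨t, rfl⟩ := exists_add_of_le hle
    rw [Finsupp.sum_add_index' (by simp) (by simp), Finsupp.sum_single_index rfl] at hs
    obtain ⟨c, ℓ, h⟩ := monomial_degree_le_one t (by omega)
    refine ⟨0, c • EuclideanSpace.proj i, (EuclideanSpace.proj i : E d →L[ℝ] ℝ).smulRight ℓ,
      fun x => ?_⟩
    rw [Finsupp.prod_add_index' (by simp) (by intros; ring), Finsupp.prod_single_index (by simp), h]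
    simp [quad]; ring

theorem IsPolyOn.exists_affine {s : Set (E d)} {u : E d → ℝ} (h : IsPolyOn 1 s u) :
    ∃ (c : ℝ) (ℓ : E d →L[ℝ] ℝ), ∀ x ∈ s, u x = c + ℓ x := by
  obtain ⟨P, hP, hu⟩ := h
  choose! c ℓ hc using fun (m : Fin d →₀ ℕ) (hm : (m.sum fun _ e => e) ≤ 1) =>
    monomial_degree_le_one m hm
  refine ⟨∑ m ∈ P.support, P.coeff m * c m, ∑ m ∈ P.support, P.coeff m • ℓ m, fun x hx => ?_⟩
  rw [hu x hx, MvPolynomial.eval_eq, sum_apply, ← Finset.sum_add_distrib]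
  refine Finset.sum_congr rfl fun m hm => ?_
  have := hc m ((MvPolynomial.le_totalDegree hm).trans hP) x
  rw [Finsupp.prod] at this
  rw [this]; simp; ring

theorem IsPolyOn.exists_quad {s : Set (E d)} {u : E d → ℝ} (h : IsPolyOn 2 s u) :
    ∃ (c : ℝ) (ℓ : E d →L[ℝ] ℝ) (B : E d →L[ℝ] E d →L[ℝ] ℝ), ∀ x ∈ s, u x = quad c ℓ B x := by
  obtain ⟨P, hP, hu⟩ := h
  choose! c ℓ B hc using fun (m : Fin d →₀ ℕ) (hm : (m.sum fun _ e => e) ≤ 2) =>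
    monomial_degree_le_two m hm
  refine ⟨∑ m ∈ P.support, P.coeff m * c m, ∑ m ∈ P.support, P.coeff m • ℓ m,
    ∑ m ∈ P.support, P.coeff m • B m, fun x hx => ?_⟩
  rw [hu x hx, MvPolynomial.eval_eq, quad, sum_apply,
    sum_apply, sum_apply,
    ← Finset.sum_add_distrib, ← Finset.sum_add_distrib]
  refine Finset.sum_congr rfl fun m hm => ?_
  have := hc m ((MvPolynomial.le_totalDegree hm).trans hP) x
  rw [Finsupp.prod] at this
  rw [this, quad]; simp; ring

/-- An affine function that vanishes on a disc of the hyperplane `{ν · (x - s) = 0}` is a multiple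
of `ν · (x - s)`. -/
theorem affine_eq_of_vanish {ν : E d} (hν : ‖ν‖ = 1) (s : E d) {ρ : ℝ} (hρ : 0 < ρ) {c : ℝ}
    {ℓ : E d →L[ℝ] ℝ} (h : ∀ x ∈ Metric.closedBall s ρ, ⟪ν, x - s⟫ = 0 → c + ℓ x = 0) :
    ∃ k : ℝ, ∀ x, c + ℓ x = k * ⟪ν, x - s⟫ := by
  have hs : c + ℓ s = 0 := h s (Metric.mem_closedBall_self hρ.le) (by simp)
  have hz : ∀ z, ⟪ν, z⟫ = 0 → ℓ z = 0 := by
    intro z hz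
    by_cases h0 : z = 0
    · simp [h0]
    have hn : 0 < ‖z‖ := norm_pos_iff.2 h0
    have := h (s + (ρ / ‖z‖) • z) (by simp [norm_smul, abs_of_pos hρ, hn.ne'])
      (by simp [inner_smul_right, hz])
    rw [map_add, map_smul, ← add_assoc, hs, zero_add, smul_eq_mul] at this
    exact (mul_eq_zero.1 this).resolve_left (by positivity)
  -- Split `x - s` into its normal and tangential parts.
  refine ⟨ℓ ν, fun x => ?_⟩
  have h1 := hz ((x - s) - ⟪ν, x - s⟫ • ν) (by
    rw [inner_sub_right, inner_smul_right, real_inner_self_eq_norm_sq, hν]; ring)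
  rw [map_sub, map_sub, map_smul, smul_eq_mul] at h1
  linarith

/-- A quadratic function that vanishes on a disc of the hyperplane `{ν · (x - s) = 0}` is the
product of `ν · (x - s)` and an affine function. -/
theorem quad_eq_of_vanish {ν : E d} (hν : ‖ν‖ = 1) (s : E d) {ρ : ℝ} (hρ : 0 < ρ) {c : ℝ}
    {ℓ : E d →L[ℝ] ℝ} {B : E d →L[ℝ] E d →L[ℝ] ℝ}
    (h : ∀ x ∈ Metric.closedBall s ρ, ⟪ν, x - s⟫ = 0 → quad c ℓ B x = 0) :
    ∃ (a : ℝ) (w : E d), ∀ x, quad c ℓ B x = ⟪ν, x - s⟫ * (a + ⟪w, x - s⟫) := by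
  have hexp : ∀ u, quad c ℓ B (s + u) = quad c ℓ B s + (ℓ u + B s u + B u s) + B u u := by
    intro u; simp [quad]; ring
  have hs : quad c ℓ B s = 0 := h s (Metric.mem_closedBall_self hρ.le) (by simp)
  -- The tangential coefficients of the expansion at `s` vanish.
  have hz : ∀ z, ⟪ν, z⟫ = 0 → ℓ z + B s z + B z s = 0 ∧ B z z = 0 := by
    intro z hz
    by_cases h0 : z = 0
    · simp [h0]
    have hn : 0 < ‖z‖ := norm_pos_iff.2 h0
    set τ := ρ / ‖z‖ with hτ
    have hτ0 : 0 < τ := by positivity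
    have h1 := h (s + τ • z) (by simp [norm_smul, hτ, abs_of_pos hρ, hn.ne'])
      (by simp [inner_smul_right, hz])
    have h2 := h (s + (-τ) • z) (by simp [norm_smul, hτ, abs_of_pos hρ, hn.ne'])
      (by simp [inner_smul_right, hz])
    rw [hexp, hs] at h1 h2
    simp only [map_smul, smul_apply, smul_eq_mul] at h1 h2
    constructor
    · have : τ * (ℓ z + B s z + B z s) = 0 := by linarith
      exact (mul_eq_zero.1 this).resolve_left hτ0.ne'
    · have : τ ^ 2 * B z z = 0 := by linarith
      exact (mul_eq_zero.1 this).resolve_left (by positivity)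
  set m : E d →L[ℝ] ℝ := B ν + B.flip ν - B ν ν • innerSL ℝ ν with hm
  refine ⟨ℓ ν + B s ν + B ν s, (InnerProductSpace.toDual ℝ (E d)).symm m, fun x => ?_⟩
  rw [InnerProductSpace.toDual_symm_apply]
  set t := ⟪ν, x - s⟫ with ht
  obtain ⟨h1, h2⟩ := hz ((x - s) - t • ν) (by
    rw [inner_sub_right, inner_smul_right, real_inner_self_eq_norm_sq, hν, ← ht]; ring)
  have hx := hexp (x - s)
  rw [add_sub_cancel, hs] at hx
  rw [hx]
  have hmx : m (x - s) = B ν (x - s) + B (x - s) ν - B ν ν * t := by simp [hm, ht]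
  rw [hmx]
  generalize x - s = u at *
  simp only [map_sub, map_smul, sub_apply, smul_apply, smul_eq_mul] at h1 h2
  linear_combination h1 + h2

/-! ### Weak derivatives and the very weak form of the Stokes equations -/

theorem IsTestFunction.isCc {Ω : Set (E d)} {φ : E d → ℝ} (h : IsTestFunction Ω φ) : IsCc φ :=
  ⟨h.1, h.2.1⟩

theorem IsTestFunction.fderiv_apply {Ω : Set (E d)} {φ : E d → ℝ} (h : IsTestFunction Ω φ)
    (w : E d) : IsTestFunction Ω fun x => fderiv ℝ φ x w :=
  ⟨(h.isCc.fderiv_apply w).1, (h.isCc.fderiv_apply w).2,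
    (tsupport_fderiv_apply_subset ℝ w).trans h.2.2⟩

theorem isTestFunction_zero (Ω : Set (E d)) : IsTestFunction Ω fun _ => 0 :=
  ⟨contDiff_const, HasCompactSupport.zero,
    (tsupport_eq_empty_iff (f := fun _ : E d => (0 : ℝ))).2 rfl ▸ empty_subset _⟩

theorem IsTestFunction.eq_zero {Ω : Set (E d)} {φ : E d → ℝ} (h : IsTestFunction Ω φ) {x : E d}
    (hx : x ∉ Ω) : φ x = 0 :=
  image_eq_zero_of_notMem_tsupport fun h' => hx (h.2.2 h')

theorem continuous_gradient {φ : E d → ℝ} (h : IsCc φ) : Continuous (gradient φ) :=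
  (InnerProductSpace.toDual ℝ (E d)).symm.continuous.comp (h.1.continuous_fderiv (by simp))

theorem IsTestFunction.hasWeakGrad {Ω : Set (E d)} {φ : E d → ℝ} (h : IsTestFunction Ω φ) :
    HasWeakGrad Ω φ (gradient φ) := by
  refine ⟨h.isCc.continuous.locallyIntegrable.locallyIntegrableOn _,
    (continuous_gradient h.isCc).locallyIntegrable.locallyIntegrableOn _, fun ψ hψ i => ?_⟩
  simp_rw [gradient_apply]
  rw [setIntegral_eq_integral_of_forall_compl_eq_zero fun x hx => by rw [h.eq_zero hx, zero_mul],
    setIntegral_eq_integral_of_forall_compl_eq_zero fun x hx => by rw [hψ.eq_zero hx, mul_zero]]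
  exact hψ.isCc.integral_mul_fderiv h.1 _

/-- Weak gradients are unique up to null sets. -/
theorem HasWeakGrad.ae_eq {Ω : Set (E d)} (hΩ : IsOpen Ω) {u : E d → ℝ} {g g' : E d → E d}
    (h : HasWeakGrad Ω u g) (h' : HasWeakGrad Ω u g') : g =ᵐ[volume.restrict Ω] g' := by
  have hloc : LocallyIntegrableOn (fun x => g x - g' x) Ω := h.2.1.sub h'.2.1
  have hi : ∀ i : Fin d, ∀ᵐ x : E d, x ∈ Ω → (g x - g' x) i = 0 := by
    intro i
    have hcomp : ∀ {G : E d → E d}, LocallyIntegrableOn G Ω →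
        LocallyIntegrableOn (fun x => G x i) Ω := fun hG x hx =>
      (hG x hx).imp fun s hs => ⟨hs.1, (EuclideanSpace.proj (𝕜 := ℝ) i).integrable_comp hs.2⟩
    refine hΩ.ae_eq_zero_of_integral_contDiff_smul_eq_zero (hcomp hloc) fun ψ h1 h2 h3 => ?_
    have hψ : IsTestFunction Ω ψ := ⟨h1, h2, h3⟩
    have hint : ∀ {G : E d → E d}, LocallyIntegrableOn G Ω →
        IntegrableOn (fun x => G x i * ψ x) Ω := by
      intro G hG
      have hK := ((hcomp hG).integrableOn_compact_subset hψ.2.2 hψ.2.1).mul_continuousOn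
        hψ.isCc.continuous.continuousOn hψ.2.1
      refine ((integrableOn_iff_integrable_of_support_subset fun x hx => ?_).1 hK).integrableOn
      exact subset_tsupport _ (right_ne_zero_of_mul hx)
    have e1 := h.2.2 ψ hψ i
    have e2 := h'.2.2 ψ hψ i
    have e3 : ∫ x in Ω, g x i * ψ x - g' x i * ψ x = 0 := by
      rw [integral_sub (hint h.2.1) (hint h'.2.1)]; linarith
    rw [← e3, setIntegral_eq_integral_of_forall_compl_eq_zero fun x hx => by
      rw [hψ.eq_zero hx]; simp]
    refine integral_congr_ae (Filter.Eventually.of_forall fun x => ?_)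
    simp; ring
  refine (ae_restrict_iff' hΩ.measurableSet).2 ?_
  filter_upwards [ae_all_iff.2 hi] with x hx hxΩ
  ext i
  have := hx i hxΩ
  simp only [PiLp.sub_apply] at this
  linarith

theorem hasWeakGrad_weakGrad {Ω : Set (E d)} {u : E d → ℝ} (h : ∃ g, HasWeakGrad Ω u g) :
    HasWeakGrad Ω u (weakGrad Ω u) := by
  rw [weakGrad, dif_pos h]; exact h.choose_spec

theorem IsTestFunction.weakGrad_ae_eq {Ω : Set (E d)} (hΩ : IsOpen Ω) {φ : E d → ℝ}
    (h : IsTestFunction Ω φ) : weakGrad Ω φ =ᵐ[volume.restrict Ω] gradient φ :=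
  (hasWeakGrad_weakGrad ⟨_, h.hasWeakGrad⟩).ae_eq hΩ h.hasWeakGrad

theorem IsCc.memLp {φ : E d → ℝ} (h : IsCc φ) (p : ℝ≥0∞) (Ω : Set (E d)) :
    MemLp φ p (volume.restrict Ω) :=
  (h.continuous.memLp_of_hasCompactSupport h.2).restrict Ω

theorem IsTestFunction.memH01 {Ω : Set (E d)} (hΩ : IsOpen Ω) {φ : E d → ℝ}
    (h : IsTestFunction Ω φ) : MemH01 Ω φ := by
  have hg : MemLp (gradient φ) 2 (volume.restrict Ω) :=
    ((continuous_gradient h.isCc).memLp_of_hasCompactSupport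
      ((h.2.1.fderiv ℝ).comp_left (map_zero _))).restrict Ω
  refine ⟨⟨h.isCc.memLp 2 Ω, ⟨_, h.hasWeakGrad⟩,
    (memLp_congr_ae (h.weakGrad_ae_eq hΩ)).2 hg⟩, fun ε _ => ⟨φ, h, ?_, ?_⟩⟩
  · simp
  · have : (fun x => weakGrad Ω φ x - gradient φ x) =ᵐ[volume.restrict Ω] 0 := by
      filter_upwards [h.weakGrad_ae_eq hΩ] with x hx
      simp [hx]
    rw [eLpNorm_congr_ae this]; simp

/-- The vector field `φ eᵢ`. -/
def singleField (i : Fin d) (φ : E d → ℝ) (x : E d) : E d := φ x • stdVec i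

theorem singleField_apply_self (i : Fin d) (φ : E d → ℝ) : (fun x => singleField i φ x i) = φ := by
  ext x; simp [singleField]

theorem singleField_apply_of_ne {i j : Fin d} (h : j ≠ i) (φ : E d → ℝ) :
    (fun x => singleField i φ x j) = fun _ => 0 := by
  ext x; simp [singleField, h]

theorem IsTestFunction.memH01Vec_singleField {Ω : Set (E d)} (hΩ : IsOpen Ω) {φ : E d → ℝ}
    (h : IsTestFunction Ω φ) (i : Fin d) : MemH01Vec Ω (singleField i φ) := by
  intro j
  by_cases hj : j = i
  · subst hj; rw [singleField_apply_self]; exact h.memH01 hΩ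
  · rw [singleField_apply_of_ne hj]; exact (isTestFunction_zero Ω).memH01 hΩ

theorem weakGrad_zero_ae {Ω : Set (E d)} (hΩ : IsOpen Ω) :
    weakGrad Ω (fun _ => (0 : ℝ)) =ᵐ[volume.restrict Ω] 0 := by
  filter_upwards [(isTestFunction_zero Ω).weakGrad_ae_eq hΩ] with x hx
  rw [hx]
  ext i; rw [gradient_apply]; simp

theorem weakGrad_component_memLp {Ω : Set (E d)} {u : E d → ℝ} (hu : MemH1 Ω u) (j : Fin d) :
    MemLp (fun x => weakGrad Ω u x j) 2 (volume.restrict Ω) :=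
  (EuclideanSpace.proj (𝕜 := ℝ) j).comp_memLp' hu.2.2

section Stokes

variable {Ω : Set (E d)} {f y : E d → E d} {p : E d → ℝ} {φ : E d → ℝ}

/-- Two integrations by parts in the momentum equation: no derivatives of the solution are left. -/
theorem IsStokesSolution.very_weak (hΩ : IsOpen Ω) (h : IsStokesSolution Ω f y p)
    (hφ : IsTestFunction Ω φ) (i : Fin d) :
    ∫ x in Ω, f x i * φ x =
      - (∫ x in Ω, y x i * lap φ x) - ∫ x in Ω, p x * fderiv ℝ φ x (stdVec i) := by
  have hm := h.momentum _ (hφ.memH01Vec_singleField hΩ i)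
  have hy := (h.memH01 i).1
  have hD := fun j : Fin d => hφ.fderiv_apply (stdVec j)
  have e1 : ∫ x in Ω, ⟪f x, singleField i φ x⟫ = ∫ x in Ω, f x i * φ x := by
    congr 1 with x
    simp [singleField, inner_smul_right, EuclideanSpace.inner_single_right, mul_comm]
  have e2 : formB Ω (singleField i φ) p = - ∫ x in Ω, p x * fderiv ℝ φ x (stdVec i) := by
    unfold formB
    congr 1
    refine integral_congr_ae ?_
    filter_upwards [hφ.weakGrad_ae_eq hΩ, weakGrad_zero_ae hΩ] with x hx h0
    rw [Finset.sum_eq_single i, singleField_apply_self, hx, gradient_apply]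
    · intro j _ hj; rw [singleField_apply_of_ne hj, h0]; simp
    · simp
  have e3 : formA Ω y (singleField i φ) = - ∫ x in Ω, y x i * lap φ x := by
    unfold formA
    rw [Finset.sum_eq_single i]
    · rw [singleField_apply_self]
      have : ∫ x in Ω, ⟪weakGrad Ω (fun z => y z i) x, weakGrad Ω φ x⟫ =
          ∫ x in Ω, ∑ j, weakGrad Ω (fun z => y z i) x j * fderiv ℝ φ x (stdVec j) := by
        refine integral_congr_ae ?_
        filter_upwards [hφ.weakGrad_ae_eq hΩ] with x hx
        rw [hx, ← sum_mul_stdVec]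
        simp_rw [gradient_apply]
      rw [this, integral_finsetSum]
      · simp_rw [lap, Finset.mul_sum]
        rw [integral_finsetSum, ← Finset.sum_neg_distrib]
        · refine Finset.sum_congr rfl fun j _ => ?_
          have := (hasWeakGrad_weakGrad hy.2.1).2.2 _ (hD j) j
          simp_rw [gradient_apply] at this
          rw [this, neg_neg]
        · exact fun j _ => hy.1.integrable_mul (((hD j).fderiv_apply (stdVec j)).isCc.memLp 2 Ω)
      · exact fun j _ => (weakGrad_component_memLp hy j).integrable_mul ((hD j).isCc.memLp 2 Ω)
    · intro j _ hj
      rw [singleField_apply_of_ne hj]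
      refine integral_eq_zero_of_ae ?_
      filter_upwards [weakGrad_zero_ae hΩ] with x h0
      rw [h0]; simp
    · simp
  rw [e1, e2, e3] at hm
  linarith

theorem IsStokesSolution.very_weak_incompressible (h : IsStokesSolution Ω f y p)
    (hφ : IsTestFunction Ω φ) : ∑ i, ∫ x in Ω, y x i * fderiv ℝ φ x (stdVec i) = 0 := by
  have hb := h.incompressible φ (hφ.isCc.memLp 2 Ω)
  have e : ∀ i, ∫ x in Ω, y x i * fderiv ℝ φ x (stdVec i) =
      - ∫ x in Ω, φ x * weakGrad Ω (fun z => y z i) x i := by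
    intro i
    have := (hasWeakGrad_weakGrad (h.memH01 i).1.2.1).2.2 _ hφ i
    simp_rw [gradient_apply] at this
    rw [this]; simp_rw [mul_comm]
  unfold formB at hb
  simp_rw [Finset.mul_sum] at hb
  rw [integral_finsetSum] at hb
  · simp_rw [e, Finset.sum_neg_distrib]; exact hb
  · exact fun i _ => (hφ.isCc.memLp 2 Ω).integrable_mul (weakGrad_component_memLp (h.memH01 i).1 i)

end Stokes

/-! ### Local estimates on a ball -/

theorem bump_isTestFunction {Ω : Set (E d)} {s : E d} {ρ : ℝ} (hρ : 0 < ρ)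
    (hB : Metric.closedBall s ρ ⊆ Ω) : IsTestFunction Ω (bump s ρ) :=
  ⟨(bump_isCc s hρ).1, (bump_isCc s hρ).2, (bump_tsupport s hρ).trans hB⟩

theorem IsTestFunction.lap {Ω : Set (E d)} {φ : E d → ℝ} (h : IsTestFunction Ω φ) :
    IsTestFunction Ω (lap φ) := by
  refine ⟨h.isCc.lap.1, h.isCc.lap.2, ?_⟩
  refine (closure_minimal ?_ (isClosed_tsupport φ)).trans h.2.2
  intro x hx
  by_contra hxs
  refine hx (Finset.sum_eq_zero fun i _ => ?_)
  have := ((tsupport_fderiv_apply_subset ℝ (stdVec i)).trans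
    (tsupport_fderiv_apply_subset ℝ (f := φ) (stdVec i)))
  exact image_eq_zero_of_notMem_tsupport
    (f := fun x => fderiv ℝ (fun z => fderiv ℝ φ z (stdVec i)) x (stdVec i)) fun h' => hxs (this h')

theorem setIntegral_mul_congr {Ω B : Set (E d)} {F G ψ : E d → ℝ} (hψ : IsTestFunction B ψ)
    (hB : B ⊆ Ω) (h : ∀ x ∈ B, F x = G x) : ∫ x in Ω, F x * ψ x = ∫ x, G x * ψ x := by
  rw [setIntegral_eq_integral_of_forall_compl_eq_zero fun x hx => by
    rw [hψ.eq_zero fun h' => hx (hB h'), mul_zero]]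
  congr 1 with x
  by_cases hx : x ∈ B
  · rw [h x hx]
  · rw [hψ.eq_zero hx]; simp

theorem integrableOn_mul_congr {Ω B : Set (E d)} {F G ψ : E d → ℝ} (hψ : IsTestFunction B ψ)
    (hG : Continuous G) (h : ∀ x ∈ B, F x = G x) : IntegrableOn (fun x => F x * ψ x) Ω := by
  have : (fun x => F x * ψ x) = fun x => G x * ψ x := by
    ext x
    by_cases hx : x ∈ B
    · rw [h x hx]
    · rw [hψ.eq_zero hx]; simp
  rw [this]
  exact (hψ.isCc.integrable_mul hG).integrableOn

theorem abs_setIntegral_mul_le {Ω B : Set (E d)} {g ψ : E d → ℝ} (hψ : IsTestFunction B ψ) {M : ℝ}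
    (h : ∀ᵐ x, x ∈ B → |g x| ≤ M) : |∫ x in Ω, g x * ψ x| ≤ M * ∫ x, |ψ x| := by
  have hae : ∀ᵐ x, |g x * ψ x| ≤ M * |ψ x| := by
    filter_upwards [h] with x hx
    by_cases hxB : x ∈ B
    · rw [abs_mul]; exact mul_le_mul_of_nonneg_right (hx hxB) (abs_nonneg _)
    · rw [hψ.eq_zero hxB]; simp
  have hint : Integrable fun x => M * |ψ x| := hψ.isCc.integrable.abs.const_mul M
  calc |∫ x in Ω, g x * ψ x| ≤ ∫ x in Ω, M * |ψ x| :=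
        norm_integral_le_of_norm_le (f := fun x => g x * ψ x) hint.integrableOn
          (ae_restrict_of_ae hae)
    _ ≤ ∫ x, M * |ψ x| := setIntegral_le_integral hint
        (hae.mono fun x hx => (abs_nonneg _).trans hx)
    _ = M * ∫ x, |ψ x| := integral_const_mul _ _

theorem integral_quad_mul_lap (c : ℝ) (ℓ : E d →L[ℝ] ℝ) (B : E d →L[ℝ] E d →L[ℝ] ℝ) {φ : E d → ℝ}
    (hφ : IsCc φ) :
    ∫ x, quad c ℓ B x * lap φ x = (∑ i, 2 * B (stdVec i) (stdVec i)) * ∫ x, φ x := by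
  have hu := contDiff_quad c ℓ B
  have hu' : ∀ i : Fin d, ContDiff ℝ ∞ fun x => fderiv ℝ (quad c ℓ B) x (stdVec i) := fun i =>
    (hu.fderiv_right (m := ∞) (by simp)).clm_apply contDiff_const
  have hD := fun i : Fin d => hφ.fderiv_apply (stdVec i)
  simp_rw [lap, Finset.mul_sum]
  rw [integral_finsetSum _ fun i _ => ((hD i).fderiv_apply _).integrable_mul hu.continuous]
  simp_rw [fun i => (hD i).integral_mul_fderiv hu (stdVec i),
    fun i => hφ.integral_mul_fderiv (hu' i) (stdVec i), neg_neg]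
  rw [← integral_finsetSum, ← integral_const_mul]
  · congr 1 with x
    rw [← Finset.sum_mul, ← lap_quad c ℓ B x, lap]
  · exact fun i _ => hφ.integrable_mul ((hu' i).continuous_fderiv (by simp) |>.clm_apply
      continuous_const)

theorem integral_affine_mul_fderiv (α : ℝ) (m : E d →L[ℝ] ℝ) {φ : E d → ℝ} (hφ : IsCc φ)
    (v : E d) : ∫ x, (α + m x) * fderiv ℝ φ x v = - (m v * ∫ x, φ x) := by
  rw [hφ.integral_mul_fderiv (contDiff_const.add m.contDiff), ← integral_const_mul]
  congr 2 with x
  rw [(m.hasFDerivAt.const_add α).fderiv]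

section Stokes

variable {Ω : Set (E d)} {f y yT : E d → E d} {p pT : E d → ℝ} {s : E d} {ρ : ℝ}

theorem integrableOn_component_mul (hf : MemLp f ∞ (volume.restrict Ω)) (i : Fin d) {φ : E d → ℝ}
    (hφ : IsCc φ) : IntegrableOn (fun x => f x i * φ x) Ω :=
  MemLp.integrable_mul (p := ∞) (q := 1) ((EuclideanSpace.proj (𝕜 := ℝ) i).comp_memLp' hf)
    (hφ.memLp 1 Ω)

/-- The residual equation tested with a radial bump on whose support the discrete velocity and
pressure are polynomials on either side of the hyperplane `{ν · (x - s) = 0}`. The residual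
consists of a volume part and of the jump `a` of the normal derivative at `s`. -/
theorem IsStokesSolution.residual_identity (hΩ : IsOpen Ω) (h : IsStokesSolution Ω f y p)
    (hf : MemLp f ∞ (volume.restrict Ω)) (hρ : 0 < ρ) (hB : Metric.closedBall s ρ ⊆ Ω) {i : Fin d}
    {ν : E d} (hν : ‖ν‖ = 1) {c : ℝ} {ℓ : E d →L[ℝ] ℝ} {B : E d →L[ℝ] E d →L[ℝ] ℝ} {a : ℝ}
    {w : E d} {α k : ℝ} {m : E d →L[ℝ] ℝ}
    (hy : ∀ x ∈ Metric.closedBall s ρ,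
      yT x i = quad c ℓ B x + max ⟪ν, x - s⟫ 0 * (a + ⟪w, x - s⟫))
    (hp : ∀ x ∈ Metric.closedBall s ρ, pT x = α + m x + k * max ⟪ν, x - s⟫ 0) :
    (∫ x in Ω, (f x i + ((∑ j, 2 * B (stdVec j) (stdVec j)) - m (stdVec i)) +
        (halfSpace ν s).indicator (fun _ => 2 * ⟪ν, w⟫ - k * ν i) x) * bump s ρ x) +
      a * (ρ ^ d * ρ⁻¹ * sideMass ν) =
    - (∫ x in Ω, (y x i - yT x i) * lap (bump s ρ) x) -
      ∫ x in Ω, (p x - pT x) * fderiv ℝ (bump s ρ) x (stdVec i) := by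
  have hν0 : ν ≠ 0 := by rintro rfl; simp at hν
  have hφ := bump_isTestFunction hρ (subset_refl (Metric.closedBall s ρ))
  have hφΩ := bump_isTestFunction hρ hB
  have hφc := bump_isCc s hρ
  have hφi := hφ.fderiv_apply (stdVec i)
  have hcont : Continuous fun x : E d => max ⟪ν, x - s⟫ 0 := by fun_prop
  have hq := (contDiff_quad c ℓ B).continuous
  set S₀ := (∑ j, 2 * B (stdVec j) (stdVec j)) - m (stdVec i) with hS₀
  set S₁ := 2 * ⟪ν, w⟫ - k * ν i with hS₁
  have hGy : Continuous fun x => quad c ℓ B x + max ⟪ν, x - s⟫ 0 * (a + ⟪w, x - s⟫) :=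
    hq.add (hcont.mul (by fun_prop))
  have hGp : Continuous fun x => α + m x + k * max ⟪ν, x - s⟫ 0 := by fun_prop
  have hvw := h.very_weak hΩ hφΩ i
  have e1 : ∫ x in Ω, (y x i - yT x i) * lap (bump s ρ) x =
      (∫ x in Ω, y x i * lap (bump s ρ) x) - ∫ x in Ω, yT x i * lap (bump s ρ) x := by
    simp_rw [sub_mul]
    exact integral_sub ((h.memH01 i).1.1.integrable_mul (hφc.lap.memLp 2 Ω))
      (integrableOn_mul_congr hφ.lap hGy hy)
  have e2 : ∫ x in Ω, (p x - pT x) * fderiv ℝ (bump s ρ) x (stdVec i) =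
      (∫ x in Ω, p x * fderiv ℝ (bump s ρ) x (stdVec i)) -
        ∫ x in Ω, pT x * fderiv ℝ (bump s ρ) x (stdVec i) := by
    simp_rw [sub_mul]
    exact integral_sub (h.memL2.integrable_mul (hφi.isCc.memLp 2 Ω))
      (integrableOn_mul_congr hφi hGp hp)
  have e3 : ∫ x in Ω, yT x i * lap (bump s ρ) x =
      (∑ j, 2 * B (stdVec j) (stdVec j)) * (∫ x, bump s ρ x) + a * (ρ ^ d * ρ⁻¹ * sideMass ν) +
        2 * ⟪ν, w⟫ * ∫ x in halfSpace ν s, bump s ρ x := by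
    rw [setIntegral_mul_congr hφ.lap hB hy]
    have : ∀ x, (quad c ℓ B x + max ⟪ν, x - s⟫ 0 * (a + ⟪w, x - s⟫)) * lap (bump s ρ) x =
        quad c ℓ B x * lap (bump s ρ) x + a * (max ⟪ν, x - s⟫ 0 * lap (bump s ρ) x) +
          max ⟪ν, x - s⟫ 0 * (⟪w, x - s⟫ * lap (bump s ρ) x) := fun x => by ring
    simp_rw [this]
    have i1 := hφc.lap.integrable_mul hq
    have i2 := (hφc.lap.integrable_mul hcont).const_mul a
    have i3 : Integrable fun x => max ⟪ν, x - s⟫ 0 * (⟪w, x - s⟫ * lap (bump s ρ) x) := by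
      have := hφc.lap.integrable_mul
        (show Continuous fun x : E d => max ⟪ν, x - s⟫ 0 * ⟪w, x - s⟫ by fun_prop)
      simpa only [mul_assoc] using this
    have i12 : Integrable fun x => quad c ℓ B x * lap (bump s ρ) x +
        a * (max ⟪ν, x - s⟫ 0 * lap (bump s ρ) x) := i1.add i2
    rw [integral_add i12 i3, integral_add i1 i2, integral_quad_mul_lap _ _ _ hφc,
      integral_const_mul, integral_posPart_mul_lap_bump s hν hρ,
      integral_posPart_mul_inner_mul_lap_bump s hν0 w hρ]
  have e4 : ∫ x in Ω, pT x * fderiv ℝ (bump s ρ) x (stdVec i) =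
      - (m (stdVec i) * ∫ x, bump s ρ x) - k * (ν i * ∫ x in halfSpace ν s, bump s ρ x) := by
    rw [setIntegral_mul_congr hφi hB hp]
    have i1 := hφi.isCc.integrable_mul (show Continuous fun x => α + m x by fun_prop)
    have i2 := (hφi.isCc.integrable_mul hcont).const_mul k
    have : ∀ x, (α + m x + k * max ⟪ν, x - s⟫ 0) * fderiv ℝ (bump s ρ) x (stdVec i) =
        (α + m x) * fderiv ℝ (bump s ρ) x (stdVec i) +
          k * (max ⟪ν, x - s⟫ 0 * fderiv ℝ (bump s ρ) x (stdVec i)) := fun x => by ring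
    simp_rw [this]
    rw [integral_add i1 i2, integral_affine_mul_fderiv _ _ hφc, integral_const_mul,
      integral_posPart_mul_fderiv hν0 s _ hφc, inner_stdVec]
    ring
  have e5 : ∫ x in Ω, (f x i + S₀ + (halfSpace ν s).indicator (fun _ => S₁) x) * bump s ρ x =
      (∫ x in Ω, f x i * bump s ρ x) + S₀ * (∫ x, bump s ρ x) +
        S₁ * ∫ x in halfSpace ν s, bump s ρ x := by
    have : ∀ x, (f x i + S₀ + (halfSpace ν s).indicator (fun _ => S₁) x) * bump s ρ x =
        f x i * bump s ρ x + S₀ * bump s ρ x +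
          S₁ * (halfSpace ν s).indicator (bump s ρ) x := by
      intro x
      by_cases hx : x ∈ halfSpace ν s
      · simp only [indicator_of_mem hx]; ring
      · simp only [indicator_of_notMem hx]; ring
    simp_rw [this]
    have i1 := integrableOn_component_mul hf i hφc
    have i2 := (hφc.integrable.const_mul S₀).integrableOn (s := Ω)
    have i3 := ((hφc.integrable.indicator (measurableSet_halfSpace ν s)).const_mul
      S₁).integrableOn (s := Ω)
    have i12 : IntegrableOn (fun x => f x i * bump s ρ x + S₀ * bump s ρ x) Ω := i1.add i2
    have e6 : ∫ x in Ω, (halfSpace ν s).indicator (bump s ρ) x =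
        ∫ x in halfSpace ν s, bump s ρ x := by
      rw [setIntegral_eq_integral_of_forall_compl_eq_zero,
        integral_indicator (measurableSet_halfSpace ν s)]
      intro x hx
      rw [indicator_apply_eq_zero]
      exact fun _ => hφΩ.eq_zero hx
    rw [integral_add i12 i3, integral_add i1 i2, integral_const_mul, integral_const_mul, e6,
      setIntegral_eq_integral_of_forall_compl_eq_zero (f := bump s ρ) fun x hx => hφΩ.eq_zero hx]
  rw [e1, e2, e3, e4, e5]
  linarith

/-- The integral of the unit bump. -/
def bumpMass (d : ℕ) : ℝ := ∫ x : E d, profile x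

/-- The sum of the `L¹`-norms of the partial derivatives of the unit bump. -/
def bumpGrad (d : ℕ) : ℝ := ∑ i : Fin d, ∫ x : E d, |fderiv ℝ profile x (stdVec i)|

/-- The `L¹`-norm of the Laplacian of the unit bump. -/
def bumpLap (d : ℕ) : ℝ := ∫ x : E d, |lap profile x|

theorem bumpMass_pos : 0 < bumpMass d := by
  have hc : Continuous (profile : E d → ℝ) := profile_contDiff.continuous
  refine hc.integral_pos_of_hasCompactSupport_nonneg_nonzero profile_isCc.2 profile_nonneg
    (x := 0) ?_
  exact (expNegInvGlue.pos_of_pos (by simp)).ne'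

theorem bumpGrad_nonneg : 0 ≤ bumpGrad d :=
  Finset.sum_nonneg fun _ _ => integral_nonneg fun _ => abs_nonneg _

theorem bumpLap_nonneg : 0 ≤ bumpLap d := integral_nonneg fun _ => abs_nonneg _

theorem integral_abs_fderiv_profile_le (i : Fin d) :
    ∫ x : E d, |fderiv ℝ profile x (stdVec i)| ≤ bumpGrad d :=
  Finset.single_le_sum (f := fun i : Fin d => ∫ x : E d, |fderiv ℝ profile x (stdVec i)|)
    (fun _ _ => integral_nonneg fun _ => abs_nonneg _) (Finset.mem_univ i)

/-- The error terms of the residual equation. -/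
theorem abs_error_integrals_le (hρ : 0 < ρ) {i : Fin d} {Me Mp : ℝ} (hMp : 0 ≤ Mp)
    (he : ∀ᵐ x, x ∈ Metric.closedBall s ρ → |y x i - yT x i| ≤ Me)
    (hε : ∀ᵐ x, x ∈ Metric.closedBall s ρ → |p x - pT x| ≤ Mp) :
    |- (∫ x in Ω, (y x i - yT x i) * lap (bump s ρ) x) -
      ∫ x in Ω, (p x - pT x) * fderiv ℝ (bump s ρ) x (stdVec i)| ≤
    ρ ^ d * (ρ⁻¹ ^ 2 * bumpLap d * Me + ρ⁻¹ * bumpGrad d * Mp) := by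
  have hφ := bump_isTestFunction hρ (subset_refl (Metric.closedBall s ρ))
  have h1 := abs_setIntegral_mul_le (Ω := Ω) hφ.lap he
  have h2 := abs_setIntegral_mul_le (Ω := Ω) (hφ.fderiv_apply (stdVec i)) hε
  rw [integral_abs_lap_bump s hρ] at h1
  rw [integral_abs_fderiv_bump s hρ] at h2
  have h3 : Mp * (ρ ^ d * ρ⁻¹ * ∫ x : E d, |fderiv ℝ profile x (stdVec i)|) ≤
      Mp * (ρ ^ d * ρ⁻¹ * bumpGrad d) := by
    gcongr; exact integral_abs_fderiv_profile_le i
  refine (abs_sub _ _).trans ?_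
  rw [abs_neg]
  unfold bumpLap
  linarith

/-- Bound for the jump at the centre of a ball, in terms of the errors and of a bound `Mr` for the
element residuals on the two sides. -/
theorem IsStokesSolution.jump_bound (hΩ : IsOpen Ω) (h : IsStokesSolution Ω f y p)
    (hf : MemLp f ∞ (volume.restrict Ω)) (hρ : 0 < ρ) (hB : Metric.closedBall s ρ ⊆ Ω) {i : Fin d}
    {ν : E d} (hν : ‖ν‖ = 1) {c : ℝ} {ℓ : E d →L[ℝ] ℝ} {B : E d →L[ℝ] E d →L[ℝ] ℝ} {a : ℝ}
    {w : E d} {α k : ℝ} {m : E d →L[ℝ] ℝ}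
    (hy : ∀ x ∈ Metric.closedBall s ρ,
      yT x i = quad c ℓ B x + max ⟪ν, x - s⟫ 0 * (a + ⟪w, x - s⟫))
    (hp : ∀ x ∈ Metric.closedBall s ρ, pT x = α + m x + k * max ⟪ν, x - s⟫ 0)
    {Me Mp Mr : ℝ} (hMp : 0 ≤ Mp)
    (he : ∀ᵐ x, x ∈ Metric.closedBall s ρ → |y x i - yT x i| ≤ Me)
    (hε : ∀ᵐ x, x ∈ Metric.closedBall s ρ → |p x - pT x| ≤ Mp)
    (hr : ∀ᵐ x, x ∈ Metric.closedBall s ρ →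
      |f x i + ((∑ j, 2 * B (stdVec j) (stdVec j)) - m (stdVec i)) +
        (halfSpace ν s).indicator (fun _ => 2 * ⟪ν, w⟫ - k * ν i) x| ≤ Mr) :
    |a| * sideMass ν ≤ ρ * bumpMass d * Mr + ρ⁻¹ * bumpLap d * Me + bumpGrad d * Mp := by
  have hid := h.residual_identity hΩ hf hρ hB hν hy hp
  have hφ := bump_isTestFunction hρ (subset_refl (Metric.closedBall s ρ))
  have h1 := abs_setIntegral_mul_le (Ω := Ω) hφ hr
  simp_rw [abs_of_nonneg (bump_nonneg s _)] at h1
  rw [integral_bump s hρ] at h1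
  have h2 := abs_error_integrals_le (Ω := Ω) hρ hMp he hε
  rw [← hid] at h2
  have h3 : |a| * (ρ ^ d * ρ⁻¹ * sideMass ν) ≤ Mr * (ρ ^ d * bumpMass d) +
      ρ ^ d * (ρ⁻¹ ^ 2 * bumpLap d * Me + ρ⁻¹ * bumpGrad d * Mp) := by
    have hpos : 0 ≤ ρ ^ d * ρ⁻¹ * sideMass ν :=
      mul_nonneg (by positivity) (sideMass_pos hν).le
    nth_rw 1 [← abs_of_nonneg hpos]
    rw [← abs_mul]
    rw [abs_le] at h1 h2 ⊢
    unfold bumpMass at *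
    constructor <;> linarith
  have hρd : 0 < ρ ^ d * ρ⁻¹ := by positivity
  refine le_of_mul_le_mul_left ?_ hρd
  calc ρ ^ d * ρ⁻¹ * (|a| * sideMass ν) = |a| * (ρ ^ d * ρ⁻¹ * sideMass ν) := by ring
    _ ≤ _ := h3
    _ = _ := by field_simp; ring

/-- Bound for an affine approximation of the element residual at the centre of a ball on which the
discrete solution is polynomial; `Mo` bounds the error of the approximation. -/
theorem IsStokesSolution.interior_bound (hΩ : IsOpen Ω) (h : IsStokesSolution Ω f y p)
    (hf : MemLp f ∞ (volume.restrict Ω)) (hρ : 0 < ρ) (hB : Metric.closedBall s ρ ⊆ Ω) {i : Fin d}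
    {c : ℝ} {ℓ : E d →L[ℝ] ℝ} {B : E d →L[ℝ] E d →L[ℝ] ℝ} {α : ℝ} {m : E d →L[ℝ] ℝ}
    (hy : ∀ x ∈ Metric.closedBall s ρ, yT x i = quad c ℓ B x)
    (hp : ∀ x ∈ Metric.closedBall s ρ, pT x = α + m x)
    {Me Mp Mo : ℝ} (hMp : 0 ≤ Mp)
    (he : ∀ᵐ x, x ∈ Metric.closedBall s ρ → |y x i - yT x i| ≤ Me)
    (hε : ∀ᵐ x, x ∈ Metric.closedBall s ρ → |p x - pT x| ≤ Mp)
    {A : ℝ} {L : E d →L[ℝ] ℝ}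
    (hr : ∀ᵐ x, x ∈ Metric.closedBall s ρ →
      |f x i + ((∑ j, 2 * B (stdVec j) (stdVec j)) - m (stdVec i)) - (A + L (x - s))| ≤ Mo) :
    |A| * bumpMass d ≤ bumpMass d * Mo + ρ⁻¹ ^ 2 * bumpLap d * Me + ρ⁻¹ * bumpGrad d * Mp := by
  -- There is no jump, so that the direction of the hyperplane is irrelevant.
  have hid := h.residual_identity hΩ hf hρ hB (i := i) (ν := stdVec i) (by simp)
    (w := 0) (a := 0) (k := 0) (by simpa using hy) (by simpa using hp)
  simp only [inner_zero_right, mul_zero, zero_mul, sub_zero, indicator_zero, add_zero] at hid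
  have hφ := bump_isTestFunction hρ (subset_refl (Metric.closedBall s ρ))
  have hφΩ := bump_isTestFunction hρ hB
  have hφc := bump_isCc s hρ
  set S₀ := (∑ j, 2 * B (stdVec j) (stdVec j)) - m (stdVec i) with hS₀
  have h1 := abs_setIntegral_mul_le (Ω := Ω) hφ hr
  simp_rw [abs_of_nonneg (bump_nonneg s _)] at h1
  have h2 := abs_error_integrals_le (Ω := Ω) hρ hMp he hε
  rw [← hid] at h2
  have e : ∫ x in Ω, (f x i + S₀ - (A + L (x - s))) * bump s ρ x =
      (∫ x in Ω, (f x i + S₀) * bump s ρ x) - A * ∫ x, bump s ρ x := by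
    simp_rw [sub_mul]
    rw [integral_sub]
    · rw [← integral_affine_mul_bump s hρ A L]
      congr 1
      exact setIntegral_eq_integral_of_forall_compl_eq_zero fun x hx => by
        rw [hφΩ.eq_zero hx, mul_zero]
    · simp_rw [add_mul]
      exact (integrableOn_component_mul hf i hφc).add (hφc.integrable.const_mul S₀).integrableOn
    · exact (hφc.integrable_mul (by fun_prop)).integrableOn
  rw [e, integral_bump s hρ] at h1
  have h3 : |A| * (ρ ^ d * bumpMass d) ≤ Mo * (ρ ^ d * bumpMass d) +
      ρ ^ d * (ρ⁻¹ ^ 2 * bumpLap d * Me + ρ⁻¹ * bumpGrad d * Mp) := by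
    have hpos : 0 ≤ ρ ^ d * bumpMass d := mul_nonneg (by positivity) bumpMass_pos.le
    nth_rw 1 [← abs_of_nonneg hpos]
    rw [← abs_mul]
    rw [abs_le] at h1 h2 ⊢
    unfold bumpMass at *
    constructor <;> linarith
  have hρd : 0 < ρ ^ d := by positivity
  refine le_of_mul_le_mul_left ?_ hρd
  linarith

/-- Bound for the discrete divergence at the centre of a ball on which the discrete velocity is
polynomial. -/
theorem IsStokesSolution.div_bound (h : IsStokesSolution Ω f y p)
    (hρ : 0 < ρ) (hB : Metric.closedBall s ρ ⊆ Ω)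
    {c : Fin d → ℝ} {ℓ : Fin d → E d →L[ℝ] ℝ} {B : Fin d → E d →L[ℝ] E d →L[ℝ] ℝ}
    (hy : ∀ x ∈ Metric.closedBall s ρ, ∀ i, yT x i = quad (c i) (ℓ i) (B i) x)
    {Me : ℝ} (he : ∀ᵐ x, x ∈ Metric.closedBall s ρ → ∀ i, |y x i - yT x i| ≤ Me)
    {A : ℝ} {L : E d →L[ℝ] ℝ}
    (hr : ∀ x, ∑ i, fderiv ℝ (quad (c i) (ℓ i) (B i)) x (stdVec i) = A + L (x - s)) :
    |A| * bumpMass d ≤ ρ⁻¹ * bumpGrad d * Me := by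
  have hφ := bump_isTestFunction hρ (subset_refl (Metric.closedBall s ρ))
  have hφc := bump_isCc s hρ
  have hφi := fun i : Fin d => hφ.fderiv_apply (stdVec i)
  have hq := fun i => contDiff_quad (c i) (ℓ i) (B i)
  have hvw := h.very_weak_incompressible (bump_isTestFunction hρ hB)
  have e1 : ∀ i, ∫ x in Ω, (y x i - yT x i) * fderiv ℝ (bump s ρ) x (stdVec i) =
      (∫ x in Ω, y x i * fderiv ℝ (bump s ρ) x (stdVec i)) +
        ∫ x, fderiv ℝ (quad (c i) (ℓ i) (B i)) x (stdVec i) * bump s ρ x := by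
    intro i
    have i1 : IntegrableOn (fun x => y x i * fderiv ℝ (bump s ρ) x (stdVec i)) Ω :=
      (h.memH01 i).1.1.integrable_mul ((hφi i).isCc.memLp 2 Ω)
    simp_rw [sub_mul]
    rw [integral_sub i1
      (integrableOn_mul_congr (hφi i) (hq i).continuous fun x hx => hy x hx i),
      setIntegral_mul_congr (hφi i) hB fun x hx => hy x hx i, hφc.integral_mul_fderiv (hq i)]
    ring
  have e2 : ∑ i, ∫ x in Ω, (y x i - yT x i) * fderiv ℝ (bump s ρ) x (stdVec i) =
      A * (ρ ^ d * bumpMass d) := by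
    simp_rw [e1, Finset.sum_add_distrib, hvw, zero_add]
    rw [← integral_finsetSum]
    · simp_rw [← Finset.sum_mul, hr]
      rw [integral_affine_mul_bump s hρ, integral_bump s hρ, bumpMass]
    · exact fun i _ => hφc.integrable_mul
        (((hq i).continuous_fderiv (by simp)).clm_apply continuous_const)
  have h3 : |A| * (ρ ^ d * bumpMass d) ≤ Me * (ρ ^ d * ρ⁻¹ * bumpGrad d) := by
    have hpos : 0 ≤ ρ ^ d * bumpMass d := mul_nonneg (by positivity) bumpMass_pos.le
    nth_rw 1 [← abs_of_nonneg hpos]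
    rw [← abs_mul, ← e2, bumpGrad, Finset.mul_sum, Finset.mul_sum]
    refine (Finset.abs_sum_le_sum_abs _ _).trans (Finset.sum_le_sum fun i _ => ?_)
    rw [← integral_abs_fderiv_bump s hρ]
    exact abs_setIntegral_mul_le (hφi i) (he.mono fun x hx hxB => hx hxB i)
  have hρd : 0 < ρ ^ d := by positivity
  refine le_of_mul_le_mul_left ?_ hρd
  linarith

end Stokes

/-! ### Geometry of the mesh -/

theorem IsConvexPolytopalDomain.isOpen {Ω : Set (E d)} (h : IsConvexPolytopalDomain Ω) :
    IsOpen Ω := by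
  obtain ⟨_, V, rfl⟩ := h; exact isOpen_interior

theorem IsConvexPolytopalDomain.subset_of_isOpen {Ω U : Set (E d)}
    (h : IsConvexPolytopalDomain Ω) (hU : IsOpen U) (hUΩ : U ⊆ closure Ω) : U ⊆ Ω := by
  obtain ⟨_, V, rfl⟩ := h
  refine interior_maximal (hUΩ.trans ?_) hU
  exact closure_minimal interior_subset (V.finite_toSet.isCompact_convexHull ℝ).isClosed

theorem isCompact_cell (T : Finset (E d)) : IsCompact (cell T) :=
  T.finite_toSet.isCompact_convexHull ℝ

theorem convex_cell (T : Finset (E d)) : Convex ℝ (cell T) := convex_convexHull ℝ _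

theorem dist_le_size {T : Finset (E d)} {x y : E d} (hx : x ∈ cell T) (hy : y ∈ cell T) :
    ‖x - y‖ ≤ size T := by
  rw [← dist_eq_norm]
  exact Metric.dist_le_diam_of_mem (isCompact_cell T).isBounded hx hy

theorem subset_cell (T : Finset (E d)) : (T : Set (E d)) ⊆ cell T := subset_convexHull ℝ _

/-- A mesh element: a `d`-simplex `T` with an inscribed ball of centre `c` and radius `r`. -/
structure IsElement (T : Finset (E d)) (c : E d) (r : ℝ) : Prop where
  indep : AffineIndependent ℝ ((↑) : T → E d)
  card : T.card = d + 1
  pos : 0 < r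
  ball : Metric.closedBall c r ⊆ cell T

namespace IsElement

variable {T : Finset (E d)} {c : E d} {r : ℝ}

theorem two_mul_le_size (h : IsElement T c r) (hd : 0 < d) : 2 * r ≤ size T := by
  have hn : ‖stdVec (⟨0, hd⟩ : Fin d)‖ = 1 := by simp
  have h1 : c + r • stdVec ⟨0, hd⟩ ∈ cell T :=
    h.ball (by simp [norm_smul, hn, abs_of_pos h.pos])
  have h2 : c - r • stdVec ⟨0, hd⟩ ∈ cell T :=
    h.ball (by simp [norm_smul, hn, abs_of_pos h.pos])
  have := dist_le_size h1 h2
  rw [show c + r • stdVec (⟨0, hd⟩ : Fin d) - (c - r • stdVec ⟨0, hd⟩) =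
    (2 * r) • stdVec ⟨0, hd⟩ by module, norm_smul, hn, Real.norm_of_nonneg
    (by linarith [h.pos])] at this
  linarith

/-- Barycentric coordinates on a mesh element: affine functions `g a + l a` with values `δ` at the
vertices, nonnegative exactly on the element; their slope is at most `1 / (2r)`, since they vary
by at most `1` on the inscribed ball. -/
theorem exists_barycentric (h : IsElement T c r) :
    ∃ (l : E d → E d →L[ℝ] ℝ) (g : E d → ℝ),
      (∀ a ∈ T, ∀ b ∈ T, g a + l a b = if a = b then 1 else 0) ∧
      (∀ x, x ∈ cell T ↔ ∀ a ∈ T, 0 ≤ g a + l a x) ∧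
      (∀ x, ∑ a ∈ T, (g a + l a x) = 1) ∧ (∀ x, ∑ a ∈ T, (g a + l a x) • a = x) ∧
      ∀ a ∈ T, ∀ u, |l a u| ≤ ‖u‖ / (2 * r) := by
  classical
  have htop : affineSpan ℝ (range ((↑) : T → E d)) = ⊤ := by
    refine (h.indep.affineSpan_eq_top_iff_card_eq_finrank_add_one).2 ?_
    simp [h.card]
  let b : AffineBasis T ℝ (E d) := ⟨(↑), h.indep, htop⟩
  have hb : ∀ a : T, b a = a := fun a => rfl
  have hrange : range b = (T : Set (E d)) := by
    ext x; simp [hb]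
  let l : E d → E d →L[ℝ] ℝ := fun a =>
    if ha : a ∈ T then LinearMap.toContinuousLinearMap (b.coord ⟨a, ha⟩).linear else 0
  let g : E d → ℝ := fun a => if ha : a ∈ T then b.coord ⟨a, ha⟩ 0 else 0
  have hc : ∀ a (ha : a ∈ T) x, g a + l a x = b.coord ⟨a, ha⟩ x := by
    intro a ha x
    have := (b.coord ⟨a, ha⟩).map_vadd 0 x
    simp only [vadd_eq_add, add_zero] at this
    simp only [l, g, dif_pos ha, LinearMap.coe_toContinuousLinearMap']
    rw [this]; ring
  have hmem : ∀ x, x ∈ cell T ↔ ∀ a ∈ T, 0 ≤ g a + l a x := by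
    intro x
    have := b.convexHull_eq_nonneg_coord
    rw [hrange] at this
    unfold cell
    rw [this]
    simp only [mem_ofPred_eq, Subtype.forall]
    exact forall₂_congr fun a ha => by rw [hc a ha]
  have hsum : ∀ x, ∑ a ∈ T, (g a + l a x) = 1 := by
    intro x
    rw [← b.sum_coord_apply_eq_one x, ← Finset.sum_coe_sort]
    exact Finset.sum_congr rfl fun a _ => hc a a.2 x
  refine ⟨l, g, ?_, hmem, hsum, ?_, ?_⟩
  · intro a ha a' ha'
    rw [hc a ha]
    have := b.coord_apply ⟨a, ha⟩ ⟨a', ha'⟩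
    rw [hb] at this
    simp only at this
    rw [this]; simp
  · intro x
    have := b.linear_combination_coord_eq_self x
    conv_rhs => rw [← this]
    rw [← Finset.sum_coe_sort]
    exact Finset.sum_congr rfl fun a _ => by rw [hc a a.2, hb]
  · intro a ha u
    have hle : ∀ x ∈ cell T, g a + l a x ≤ 1 := by
      intro x hx
      rw [← hsum x]
      exact Finset.single_le_sum (f := fun a => g a + l a x) ((hmem x).1 hx) ha
    have hr := h.pos
    have key : ∀ u : E d, ‖u‖ ≤ r → |2 * l a u| ≤ 1 := by
      intro u hu
      have h1 : c + u ∈ cell T := h.ball (by simpa using hu)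
      have h2 : c - u ∈ cell T := h.ball (by simpa using hu)
      have p1 := (hmem _).1 h1 a ha
      have p2 := (hmem _).1 h2 a ha
      have q1 := hle _ h1
      have q2 := hle _ h2
      rw [map_add] at p1 q1
      rw [map_sub] at p2 q2
      rw [abs_le]; constructor <;> linarith
    by_cases hu : u = 0
    · simp [hu]
    have hn : 0 < ‖u‖ := norm_pos_iff.2 hu
    have := key ((r / ‖u‖) • u) (by simp [norm_smul, abs_of_pos hr, hn.ne'])
    rw [map_smul, smul_eq_mul, abs_mul, abs_mul, abs_of_pos (by positivity : 0 < r / ‖u‖),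
      abs_two] at this
    rw [le_div_iff₀ (by positivity)]
    calc |l a u| * (2 * r) = (2 * (r / ‖u‖ * |l a u|)) * ‖u‖ := by field_simp
      _ ≤ 1 * ‖u‖ := by gcongr
      _ = ‖u‖ := one_mul _

/-- Two vertices of an element have distance at least the diameter of the inscribed ball. -/
theorem two_mul_le_dist (h : IsElement T c r) {a b : E d} (ha : a ∈ T) (hb : b ∈ T) (hab : a ≠ b) :
    2 * r ≤ ‖a - b‖ := by
  obtain ⟨l, g, hv, -, -, -, hl⟩ := h.exists_barycentric
  have h1 := hv a ha a ha
  have h2 := hv a ha b hb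
  have h3 := hl a ha (a - b)
  rw [if_pos rfl] at h1
  rw [if_neg hab] at h2
  rw [map_sub, show l a a - l a b = 1 by linarith, abs_one,
    le_div_iff₀ (by linarith [h.pos])] at h3
  linarith

end IsElement

/-- The centroid of a side. -/
def sideCenter (S : Finset (E d)) : E d := (d : ℝ)⁻¹ • ∑ b ∈ S, b

section side

variable {T S : Finset (E d)} {c : E d} {r : ℝ} {ν : E d}

theorem inner_sub_sideCenter (hd : 0 < d) (hS : S.card = d)
    (hν : ∀ a ∈ S, ∀ b ∈ S, ⟪ν, a - b⟫ = 0) {a : E d} (ha : a ∈ S) :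
    ⟪ν, a - sideCenter S⟫ = 0 := by
  have h1 : ∀ b ∈ S, ⟪ν, b⟫ = ⟪ν, a⟫ := fun b hb => by
    have := hν b hb a ha
    rwa [inner_sub_right, sub_eq_zero] at this
  have hd' : (d : ℝ) ≠ 0 := by positivity
  rw [sideCenter, inner_sub_right, inner_smul_right, inner_sum, Finset.sum_congr rfl h1]
  simp [hS, hd']

theorem affine_sideCenter (hd : 0 < d) (hS : S.card = d) (g : ℝ) (l : E d →L[ℝ] ℝ) :
    g + l (sideCenter S) = (d : ℝ)⁻¹ * ∑ b ∈ S, (g + l b) := by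
  have hd' : (d : ℝ) ≠ 0 := by positivity
  rw [sideCenter, map_smul, map_sum, Finset.sum_add_distrib, Finset.sum_const, hS]
  simp; field_simp

theorem inner_eq_zero_of_mem_cell (hd : 0 < d) (hS : S.card = d)
    (hν : ∀ a ∈ S, ∀ b ∈ S, ⟪ν, a - b⟫ = 0) {x : E d} (hx : x ∈ cell S) :
    ⟪ν, x - sideCenter S⟫ = 0 := by
  have hconv : Convex ℝ {x : E d | ⟪ν, x - sideCenter S⟫ = 0} := by
    have : {x : E d | ⟪ν, x - sideCenter S⟫ = 0} =
        {x : E d | innerSL ℝ ν x = ⟪ν, sideCenter S⟫} := by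
      ext x; simp [inner_sub_right, sub_eq_zero]
    rw [this]
    exact convex_hyperplane (innerSL ℝ ν).toLinearMap.isLinear _
  exact convexHull_min (fun a ha => inner_sub_sideCenter hd hS hν ha) hconv hx

open Classical in
theorem exists_insert_eq (hST : S ⊆ T) (hT : T.card = d + 1) (hS : S.card = d) :
    ∃ a, a ∉ S ∧ insert a S = T := by
  have hcard : (T \ S).card = 1 := by rw [Finset.card_sdiff_of_subset hST, hT, hS]; omega
  obtain ⟨a, ha⟩ := Finset.card_eq_one.1 hcard
  have ha' : a ∈ T \ S := by rw [ha]; simp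
  refine ⟨a, (Finset.mem_sdiff.1 ha').2, ?_⟩
  rw [Finset.insert_eq, ← ha, Finset.sdiff_union_of_subset hST]

open Classical in
/-- The distance to a side is a multiple of the barycentric coordinate of the opposite vertex. -/
theorem inner_sub_sideCenter_eq_mul (hd : 0 < d) (hS : S.card = d)
    (hν : ∀ a ∈ S, ∀ b ∈ S, ⟪ν, a - b⟫ = 0) {a x : E d} (haS : a ∉ S) {t : E d → ℝ}
    (hsum : ∑ b ∈ insert a S, t b = 1) (hcomb : ∑ b ∈ insert a S, t b • b = x) :
    ⟪ν, x - sideCenter S⟫ = t a * ⟪ν, a - sideCenter S⟫ := by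
  have e : x - sideCenter S = ∑ b ∈ insert a S, t b • (b - sideCenter S) := by
    simp_rw [smul_sub]
    rw [Finset.sum_sub_distrib, hcomb, ← Finset.sum_smul, hsum, one_smul]
  rw [e, inner_sum, Finset.sum_insert haS, Finset.sum_eq_zero, add_zero, inner_smul_right]
  intro z hz
  rw [inner_smul_right, inner_sub_sideCenter hd hS hν hz, mul_zero]

open Classical in
theorem IsUnitNormal.inner_pos (hd : 0 < d) (hS : S.card = d) {a : E d} (haS : a ∉ S)
    (hν : IsUnitNormal S (insert a S) ν) : 0 < ⟪ν, a - sideCenter S⟫ := by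
  obtain ⟨b, hb⟩ : S.Nonempty := by rw [← Finset.card_pos, hS]; exact hd
  have e1 := hν.2.2 b hb a (Finset.mem_insert_self _ _) haS
  have e2 := inner_sub_sideCenter hd hS hν.2.1 hb
  rw [inner_sub_right] at e1 e2 ⊢
  linarith

/-- Near the centroid of a side, an element coincides with a half-space. -/
theorem IsElement.halfBall_subset (h : IsElement T c r) (hd : 0 < d) (hST : S ⊆ T)
    (hS : S.card = d) (hν : IsUnitNormal S T ν) {ρ : ℝ} (hρ : d * ρ ≤ 2 * r) {x : E d}
    (hx : x ∈ Metric.closedBall (sideCenter S) ρ) (hpos : 0 ≤ ⟪ν, x - sideCenter S⟫) :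
    x ∈ cell T := by
  classical
  obtain ⟨l, g, hv, hmem, hsum, hcomb, hl⟩ := h.exists_barycentric
  obtain ⟨a, haS, rfl⟩ := exists_insert_eq hST h.card hS
  rw [hmem]
  intro b hb
  have hr := h.pos
  have hd0 : (0 : ℝ) < d := by exact_mod_cast hd
  rcases Finset.mem_insert.1 hb with rfl | hbS
  · have h1 := inner_sub_sideCenter_eq_mul hd hS hν.2.1 haS (hsum x) (hcomb x)
    have h2 := hν.inner_pos hd hS haS
    rw [h1] at hpos
    exact nonneg_of_mul_nonneg_left hpos h2
  · have h1 : g b + l b (sideCenter S) = (d : ℝ)⁻¹ := by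
      rw [affine_sideCenter hd hS, Finset.sum_congr rfl fun z hz => hv b hb z
        (Finset.mem_insert_of_mem hz), Finset.sum_ite_eq, if_pos hbS, mul_one]
    have h2 := hl b hb (x - sideCenter S)
    have h3 : ‖x - sideCenter S‖ / (2 * r) ≤ (d : ℝ)⁻¹ := by
      rw [Metric.mem_closedBall, dist_eq_norm] at hx
      rw [div_le_iff₀ (by positivity), ← div_eq_inv_mul, le_div_iff₀ hd0]
      nlinarith
    rw [map_sub] at h2
    have := (abs_le.1 h2).1
    linarith

/-- Any two normals of a side are parallel. -/
theorem IsElement.normal_parallel (h : IsElement T c r) (hd : 0 < d) (hST : S ⊆ T)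
    (hS : S.card = d) (hν : IsUnitNormal S T ν) {μ : E d} (hμ1 : ‖μ‖ = 1)
    (hμ : ∀ a ∈ S, ∀ b ∈ S, ⟪μ, a - b⟫ = 0) : μ = ν ∨ μ = -ν := by
  classical
  obtain ⟨l, g, hv, hmem, hsum, hcomb, hl⟩ := h.exists_barycentric
  obtain ⟨a, haS, rfl⟩ := exists_insert_eq hST h.card hS
  have key : ∀ η : E d, (∀ a ∈ S, ∀ b ∈ S, ⟪η, a - b⟫ = 0) → ∀ x,
      ⟪η, x - sideCenter S⟫ = (g a + l a x) * ⟪η, a - sideCenter S⟫ := fun η hη x =>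
    inner_sub_sideCenter_eq_mul hd hS hη haS (hsum x) (hcomb x)
  have h2 := hν.inner_pos hd hS haS
  have hpar : μ = (⟪μ, a - sideCenter S⟫ / ⟪ν, a - sideCenter S⟫) • ν := by
    refine ext_inner_right ℝ fun u => ?_
    have e1 := key μ hμ (sideCenter S + u)
    have e2 := key ν hν.2.1 (sideCenter S + u)
    rw [add_sub_cancel_left] at e1 e2
    rw [inner_smul_left, e1, e2]
    simp; field_simp
  set k := ⟪μ, a - sideCenter S⟫ / ⟪ν, a - sideCenter S⟫
  have hk : |k| = 1 := by
    have := hμ1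
    rw [hpar, norm_smul, hν.1, mul_one, Real.norm_eq_abs] at this
    exact this
  rcases eq_or_eq_neg_of_abs_eq hk with h' | h'
  · left; rw [hpar, h', one_smul]
  · right; rw [hpar, h', neg_smul, one_smul]

end side

section mesh

variable {Ω : Set (E d)} {K : Geometry.SimplicialComplex ℝ (E d)} {σ : ℝ}

theorem IsMesh.cell_subset_closure (hK : IsMesh Ω K) {T : Finset (E d)} (hT : T ∈ K.facets) :
    cell T ⊆ closure Ω := by
  rw [← hK.space_eq]
  exact K.convexHull_subset_space (K.facets_subset hT)

theorem IsMesh.exists_isElement (hK : IsMesh Ω K) (hσ : IsShapeRegular K σ) {T : Finset (E d)}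
    (hT : T ∈ K.facets) : ∃ c r, IsElement T c r ∧ size T ≤ σ * (2 * r) := by
  obtain ⟨c, r, hr, hball, hsize⟩ := hσ T hT
  exact ⟨c, r, ⟨K.indep (K.facets_subset hT), hK.card_facet T hT, hr, hball⟩, hsize⟩

/-- In a conforming mesh, two distinct elements with a common side meet only in that side. -/
theorem IsMesh.inter_subset_side (hK : IsMesh Ω K) {T T' S : Finset (E d)} (hT : T ∈ K.facets)
    (hT' : T' ∈ K.facets) (hne : T' ≠ T) (hS : S.card = d) (hST : S ⊆ T) (hST' : S ⊆ T') :
    cell T ∩ cell T' ⊆ cell S := by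
  classical
  have hinter : T ∩ T' = S := by
    symm
    refine Finset.eq_of_subset_of_card_le (Finset.subset_inter hST hST') ?_
    by_contra hlt
    rw [hS, not_le] at hlt
    have h1 : T ∩ T' = T := Finset.eq_of_subset_of_card_le Finset.inter_subset_left
      (by rw [hK.card_facet T hT]; omega)
    have h2 : T ∩ T' = T' := Finset.eq_of_subset_of_card_le Finset.inter_subset_right
      (by rw [hK.card_facet T' hT']; omega)
    exact hne (h2.symm.trans h1)
  have := K.inter_subset_convexHull (K.facets_subset hT) (K.facets_subset hT')
  rw [← Finset.coe_inter, hinter] at this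
  exact this

/-- The unit normals of two distinct elements at a common side are opposite: otherwise the two
elements would overlap near the centroid of the side. -/
theorem IsMesh.normal_eq_neg (hK : IsMesh Ω K) (hd : 0 < d) {T T' S : Finset (E d)}
    (hT : T ∈ K.facets) (hT' : T' ∈ K.facets) (hne : T' ≠ T) (hS : S.card = d) (hST : S ⊆ T)
    (hST' : S ⊆ T') {c c' : E d} {r r' : ℝ} (h : IsElement T c r) (h' : IsElement T' c' r')
    {ν ν' : E d} (hν : IsUnitNormal S T ν) (hν' : IsUnitNormal S T' ν') : ν' = -ν := by
  rcases h.normal_parallel hd hST hS hν hν'.1 hν'.2.1 with rfl | h1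
  · exfalso
    have hd0 : (0 : ℝ) < d := by exact_mod_cast hd
    set ρ := min (2 * r / d) (2 * r' / d) with hρ
    have hρ0 : 0 < ρ := lt_min (div_pos (by linarith [h.pos]) hd0)
      (div_pos (by linarith [h'.pos]) hd0)
    have hρ1 : d * ρ ≤ 2 * r := by
      rw [mul_comm, ← le_div_iff₀ hd0]; exact min_le_left _ _
    have hρ2 : d * ρ ≤ 2 * r' := by
      rw [mul_comm, ← le_div_iff₀ hd0]; exact min_le_right _ _
    have hx : sideCenter S + ρ • ν' ∈ Metric.closedBall (sideCenter S) ρ := by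
      simp [norm_smul, hν.1, abs_of_pos hρ0]
    have hpos : 0 < ⟪ν', sideCenter S + ρ • ν' - sideCenter S⟫ := by
      simp [inner_smul_right, hν.1, hρ0]
    have m1 := h.halfBall_subset hd hST hS hν hρ1 hx hpos.le
    have m2 := h'.halfBall_subset hd hST' hS hν' hρ2 hx hpos.le
    have := inner_eq_zero_of_mem_cell hd hS hν.2.1
      (hK.inter_subset_side hT hT' hne hS hST hST' ⟨m1, m2⟩)
    linarith
  · exact h1

/-- Elements with a common side have comparable sizes. -/
theorem IsElement.size_le (hd : 2 ≤ d) {T T' S : Finset (E d)} {c : E d} {r : ℝ}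
    (h : IsElement T c r) (hσ : size T ≤ σ * (2 * r)) (hσ0 : 0 ≤ σ) (hS : S.card = d)
    (hST : S ⊆ T) (hST' : S ⊆ T') : size T ≤ σ * size T' := by
  obtain ⟨a, ha, b, hb, hab⟩ := Finset.one_lt_card.1 (by omega : 1 < S.card)
  have h1 := h.two_mul_le_dist (hST ha) (hST hb) hab
  have h2 := dist_le_size (subset_cell T' (hST' ha)) (subset_cell T' (hST' hb))
  exact hσ.trans (mul_le_mul_of_nonneg_left (h1.trans h2) hσ0)

end mesh

/-! ### Classical derivatives of piecewise polynomials -/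

theorem laplacian_eq_lap (u : E d → ℝ) (hu : ContDiff ℝ ∞ u) (x : E d) :
    Laplacian.laplacian u x = lap u x := by
  rw [InnerProductSpace.laplacian_eq_iteratedFDeriv_orthonormalBasis u
    (EuclideanSpace.basisFun (Fin d) ℝ), lap]
  refine Finset.sum_congr rfl fun i _ => ?_
  rw [iteratedFDeriv_two_apply]
  have h : DifferentiableAt ℝ (fderiv ℝ u) x :=
    ((hu.fderiv_right (m := ∞) (by simp)).differentiable (by simp)) x
  rw [fderiv_clm_apply h (differentiableAt_const _)]
  simp

/-- On the element `T`, the velocity is quadratic and the pressure is affine, with the given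
coefficients. -/
structure IsLocalForm (T : Finset (E d)) (yT : E d → E d) (pT : E d → ℝ) (c : Fin d → ℝ)
    (ℓ : Fin d → E d →L[ℝ] ℝ) (B : Fin d → E d →L[ℝ] E d →L[ℝ] ℝ) (α : ℝ) (m : E d →L[ℝ] ℝ) :
    Prop where
  vel : ∀ x ∈ cell T, ∀ i, yT x i = quad (c i) (ℓ i) (B i) x
  pres : ∀ x ∈ cell T, pT x = α + m x

theorem exists_isLocalForm {Ω : Set (E d)} {K : Geometry.SimplicialComplex ℝ (E d)}
    {yT : E d → E d} {pT : E d → ℝ} (hy : MemV Ω K yT) (hp : MemQ Ω K pT) {T : Finset (E d)}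
    (hT : T ∈ K.facets) : ∃ c ℓ B α m, IsLocalForm T yT pT c ℓ B α m := by
  choose c ℓ B h using fun i => (hy.2.1 T hT i).exists_quad
  obtain ⟨α, m, h'⟩ := (hp.2 T hT).exists_affine
  exact ⟨c, ℓ, B, α, m, fun x hx i => h i x hx, h'⟩

namespace IsLocalForm

variable {T : Finset (E d)} {yT : E d → E d} {pT : E d → ℝ} {c : Fin d → ℝ}
  {ℓ : Fin d → E d →L[ℝ] ℝ} {B : Fin d → E d →L[ℝ] E d →L[ℝ] ℝ} {α : ℝ} {m : E d →L[ℝ] ℝ}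

theorem laplacian_apply (h : IsLocalForm T yT pT c ℓ B α m) {x : E d} (hx : x ∈ interior (cell T))
    (i : Fin d) :
    Laplacian.laplacian yT x i = ∑ j, 2 * B i (stdVec j) (stdVec j) := by
  set Q : E d → E d := fun x => WithLp.toLp 2 fun i => quad (c i) (ℓ i) (B i) x with hQ
  have hQc : ContDiff ℝ ∞ Q := contDiff_euclidean.2 fun i => contDiff_quad _ _ _
  have heq : yT =ᶠ[nhds x] Q := by
    filter_upwards [mem_interior_iff_mem_nhds.1 hx] with z hz
    ext j; rw [h.vel z hz j]
  rw [InnerProductSpace.laplacian_congr_nhds heq |>.eq_of_nhds]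
  have := ((hQc.of_le (m := 2) (WithTop.coe_le_coe.2 le_top)).contDiffAt
    (x := x)).laplacian_CLM_comp_left
    (l := (EuclideanSpace.proj i : E d →L[ℝ] ℝ))
  have e : (EuclideanSpace.proj i : E d →L[ℝ] ℝ) ∘ Q = quad (c i) (ℓ i) (B i) := by
    ext z; simp [hQ]
  rw [e, laplacian_eq_lap _ (contDiff_quad _ _ _), lap_quad] at this
  exact this.symm

theorem gradient_pres_apply (h : IsLocalForm T yT pT c ℓ B α m) {x : E d}
    (hx : x ∈ interior (cell T)) (i : Fin d) : gradient pT x i = m (stdVec i) := by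
  have heq : pT =ᶠ[nhds x] fun z => α + m z := by
    filter_upwards [mem_interior_iff_mem_nhds.1 hx] with z hz
    exact h.pres z hz
  rw [gradient_apply, heq.fderiv_eq, (m.hasFDerivAt.const_add α).fderiv]

theorem gradient_vel_apply (h : IsLocalForm T yT pT c ℓ B α m) {x : E d}
    (hx : x ∈ interior (cell T)) (i : Fin d) :
    gradient (fun z => yT z i) x i = fderiv ℝ (quad (c i) (ℓ i) (B i)) x (stdVec i) := by
  have heq : (fun z => yT z i) =ᶠ[nhds x] quad (c i) (ℓ i) (B i) := by
    filter_upwards [mem_interior_iff_mem_nhds.1 hx] with z hz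
    exact h.vel z hz i
  rw [gradient_apply, heq.fderiv_eq]

theorem fderivWithin_apply (h : IsLocalForm T yT pT c ℓ B α m) {x : E d} (hx : x ∈ cell T)
    (hT : (interior (cell T)).Nonempty) (v : E d) (i : Fin d) :
    fderivWithin ℝ yT (cell T) x v i = fderiv ℝ (quad (c i) (ℓ i) (B i)) x v := by
  set Q : E d → E d := fun x => WithLp.toLp 2 fun i => quad (c i) (ℓ i) (B i) x with hQ
  have hQc : ContDiff ℝ ∞ Q := contDiff_euclidean.2 fun i => contDiff_quad _ _ _
  have hQd : DifferentiableAt ℝ Q x := hQc.differentiable (by simp) x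
  have hu : UniqueDiffWithinAt ℝ (cell T) x := uniqueDiffOn_convex (convex_cell T) hT x hx
  have heq : ∀ z ∈ cell T, yT z = Q z := fun z hz => by
    ext j; rw [h.vel z hz j]
  rw [fderivWithin_congr heq (heq x hx), hQd.fderivWithin hu]
  have := ((EuclideanSpace.proj i : E d →L[ℝ] ℝ).hasFDerivAt.comp x hQd.hasFDerivAt).fderiv
  have e : (EuclideanSpace.proj i : E d →L[ℝ] ℝ) ∘ Q = quad (c i) (ℓ i) (B i) := by
    ext z; simp [hQ]
  rw [e] at this
  rw [this]; simp

end IsLocalForm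

theorem ae_mem_interior_cell (T : Finset (E d)) :
    ∀ᵐ x, x ∈ cell T → x ∈ interior (cell T) := by
  have h : ∀ᵐ x, x ∉ frontier (cell T) := by
    rw [ae_iff]; simpa using (convex_cell T).addHaar_frontier volume
  filter_upwards [h] with x hx hxT
  by_contra hxi
  exact hx ⟨subset_closure hxT, hxi⟩

/-- The projection is affine almost everywhere; if `f` is not square integrable, it is zero by
convention. -/
theorem proj_ae_affine (s : Set (E d)) (f : E d → E d) :
    ∃ (a : E d) (L : E d →ₗ[ℝ] E d), proj s f =ᵐ[volume.restrict s] fun x => L x + a := by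
  by_cases hf : MemLp f 2 (volume.restrict s)
  · obtain ⟨A, hA⟩ := (affineL2 s).starProjection_apply_mem (hf.toLp f)
    refine ⟨A.1.1, A.1.2, ?_⟩
    rw [proj, dif_pos hf, ← hA]
    exact (affineCoeffs_memLp A).coeFn_toLp
  · refine ⟨0, 0, ?_⟩
    rw [proj, dif_neg hf]
    exact Filter.Eventually.of_forall fun x => by simp

/-! ### Local efficiency of the three parts of the indicator -/

/-- An affine function that is bounded on a disc of a hyperplane is bounded on the larger concentric
discs. For `ν = 0` the hyperplane is the whole space. -/
theorem abs_affine_le {ν s : E d} {δ h M : ℝ} (hδ : 0 < δ) (hh : 0 < h) {a : ℝ} {L : E d →L[ℝ] ℝ}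
    (hM : ∀ x ∈ Metric.closedBall s δ, ⟪ν, x - s⟫ = 0 → |a + L x| ≤ M) {x : E d}
    (hx : ‖x - s‖ ≤ h) (hxν : ⟪ν, x - s⟫ = 0) : |a + L x| ≤ (1 + 2 * (h / δ)) * M := by
  have h1 := hM s (Metric.mem_closedBall_self hδ.le) (by simp)
  have h2 := hM (s + (δ / h) • (x - s)) (by
    rw [Metric.mem_closedBall, dist_eq_norm, add_sub_cancel_left, norm_smul,
      Real.norm_of_nonneg (by positivity), div_mul_eq_mul_div, div_le_iff₀ hh]
    exact mul_le_mul_of_nonneg_left hx hδ.le) (by simp [inner_smul_right, hxν])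
  rw [map_add, map_smul, smul_eq_mul] at h2
  have h3 : |δ / h * L (x - s)| ≤ 2 * M := by
    rw [abs_le] at h1 h2 ⊢; constructor <;> linarith
  rw [abs_mul, abs_of_pos (by positivity : 0 < δ / h)] at h3
  have h4 : |L (x - s)| ≤ 2 * (h / δ) * M := by
    calc |L (x - s)| = h / δ * (δ / h * |L (x - s)|) := by field_simp
      _ ≤ h / δ * (2 * M) := by gcongr
      _ = _ := by ring
  calc |a + L x| = |(a + L s) + L (x - s)| := by rw [map_sub]; congr 1; ring
    _ ≤ |a + L s| + |L (x - s)| := abs_add_le _ _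
    _ ≤ _ := by linarith

/-- The constant in the bound for the element residual. The bumps have radius `r / 4`, where `r` is
the radius of the inscribed ball, hence `8 σ` for the ratio of `h_T` to this radius. -/
def residualConst (d : ℕ) (σ : ℝ) : ℝ :=
  (2 + 8 * σ) *
    (1 + 64 * σ ^ 2 * (bumpLap d / bumpMass d) + 8 * σ * (bumpGrad d / bumpMass d))

/-- The constant in the bound for the divergence. -/
def divConst (d : ℕ) (σ : ℝ) : ℝ := (1 + 8 * σ) * (8 * σ * (bumpGrad d / bumpMass d))

/-- The constant in the bound for the jump; `κ` is the mass of the unit bump on a hyperplane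
through its centre. -/
def jumpConst (d : ℕ) (σ κ : ℝ) : ℝ :=
  (1 + 4 * (d * σ ^ 2)) *
    ((bumpMass d * (σ ^ 3 * residualConst d σ) + 4 * (d * σ ^ 2) * bumpLap d + bumpGrad d) / κ)

section constants

variable {σ κ : ℝ}

theorem residualConst_nonneg (hσ : 0 ≤ σ) : 0 ≤ residualConst d σ := by
  have := bumpMass_pos (d := d)
  have := bumpGrad_nonneg (d := d)
  have := bumpLap_nonneg (d := d)
  unfold residualConst; positivity

theorem divConst_nonneg (hσ : 0 ≤ σ) : 0 ≤ divConst d σ := by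
  have := bumpMass_pos (d := d)
  have := bumpGrad_nonneg (d := d)
  unfold divConst; positivity

theorem jumpConst_nonneg (hσ : 0 ≤ σ) (hκ : 0 < κ) : 0 ≤ jumpConst d σ κ := by
  have := bumpMass_pos (d := d)
  have := bumpGrad_nonneg (d := d)
  have := bumpLap_nonneg (d := d)
  have := residualConst_nonneg (d := d) hσ
  unfold jumpConst; positivity

end constants

section element

variable {Ω : Set (E d)} {f y yT : E d → E d} {p pT : E d → ℝ} {T : Finset (E d)} {z : E d}
  {r σ : ℝ} {c : Fin d → ℝ} {ℓ : Fin d → E d →L[ℝ] ℝ} {B : Fin d → E d →L[ℝ] E d →L[ℝ] ℝ}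
  {α : ℝ} {m : E d →L[ℝ] ℝ} {Me Mp O : ℝ}

theorem IsElement.closedBall_subset (hel : IsElement T z r) {s : E d}
    (hs : s ∈ Metric.closedBall z (r / 2)) : Metric.closedBall s (r / 4) ⊆ Metric.ball z r := by
  intro x hx
  rw [Metric.mem_closedBall] at hs hx
  rw [Metric.mem_ball]
  linarith [dist_triangle x s z, hel.pos]

theorem IsElement.ball_subset (hel : IsElement T z r) (hΩ : IsConvexPolytopalDomain Ω)
    (hTΩ : cell T ⊆ closure Ω) : Metric.ball z r ⊆ Ω :=
  hΩ.subset_of_isOpen Metric.isOpen_ball ((Metric.ball_subset_closedBall.trans hel.ball).trans hTΩ)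

theorem IsElement.center_mem (hel : IsElement T z r) : z ∈ cell T :=
  hel.ball (Metric.mem_closedBall_self hel.pos.le)

/-- Efficiency of the element residual. -/
theorem IsElement.residual_le (hd : 0 < d) (hΩ : IsConvexPolytopalDomain Ω)
    (h : IsStokesSolution Ω f y p) (hf : MemLp f ∞ (volume.restrict Ω)) (hel : IsElement T z r)
    (hσ : size T ≤ σ * (2 * r)) (hσ0 : 0 ≤ σ) (hTΩ : cell T ⊆ closure Ω)
    (hloc : IsLocalForm T yT pT c ℓ B α m) (hMe : 0 ≤ Me) (hMp : 0 ≤ Mp) (hO : 0 ≤ O)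
    (he : ∀ᵐ x, x ∈ cell T → ∀ i, |y x i - yT x i| ≤ Me)
    (hε : ∀ᵐ x, x ∈ cell T → |p x - pT x| ≤ Mp)
    (ho : ∀ᵐ x, x ∈ cell T → ∀ i, size T ^ 2 * |f x i - proj (cell T) f x i| ≤ O) (i : Fin d) :
    ∀ᵐ x, x ∈ cell T →
      size T ^ 2 * |f x i + ((∑ j, 2 * B i (stdVec j) (stdVec j)) - m (stdVec i))| ≤
        residualConst d σ * (Me + size T * Mp + O) := by
  have hr := hel.pos
  have hb := bumpMass_pos (d := d)
  have hg := bumpGrad_nonneg (d := d)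
  have hl := bumpLap_nonneg (d := d)
  set h₀ := size T with hh₀
  have hh : 0 < h₀ := by linarith [hel.two_mul_le_size hd]
  have hhr : h₀ / (r / 4) ≤ 8 * σ := by rw [div_le_iff₀ (by positivity)]; linarith
  set S₀ := (∑ j, 2 * B i (stdVec j) (stdVec j)) - m (stdVec i) with hS₀
  obtain ⟨a, L, hproj⟩ := proj_ae_affine (cell T) f
  rw [Filter.EventuallyEq, ae_restrict_iff' (isCompact_cell T).measurableSet] at hproj
  set Li : E d →L[ℝ] ℝ := (EuclideanSpace.proj i : E d →L[ℝ] ℝ).comp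
    (LinearMap.toContinuousLinearMap L) with hLi
  set X := Me + h₀ * Mp + O with hX
  set k₁ := bumpLap d / bumpMass d with hk₁
  set k₂ := bumpGrad d / bumpMass d with hk₂
  have hk₁0 : 0 ≤ k₁ := by positivity
  have hk₂0 : 0 ≤ k₂ := by positivity
  set N := 1 + 64 * σ ^ 2 * k₁ + 8 * σ * k₂ with hN
  have hX0 : 0 ≤ X := by positivity
  -- By the mean value property, the affine part of the residual is controlled at all points of a
  -- ball inside the element.
  have hmean : ∀ s ∈ Metric.closedBall z (r / 2), ⟪(0 : E d), s - z⟫ = 0 →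
      |(a i + S₀) + Li s| ≤ N * X / h₀ ^ 2 := by
    intro s hs _
    have hsub := hel.closedBall_subset hs
    have hsubT : Metric.closedBall s (r / 4) ⊆ cell T :=
      (hsub.trans Metric.ball_subset_closedBall).trans hel.ball
    have key := h.interior_bound hΩ.isOpen hf (by positivity : 0 < r / 4)
      (hsub.trans (hel.ball_subset hΩ hTΩ)) (i := i) (fun x hx => hloc.vel x (hsubT hx) i)
      (fun x hx => hloc.pres x (hsubT hx)) hMp
      (he.mono fun x hx hxs => hx (hsubT hxs) i) (hε.mono fun x hx hxs => hx (hsubT hxs))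
      (A := a i + S₀ + Li s) (L := Li) (Mo := O / h₀ ^ 2) (by
        filter_upwards [ho, hproj] with x hx hxp hxs
        have h1 := hx (hsubT hxs) i
        rw [hxp (hsubT hxs)] at h1
        rw [le_div_iff₀ (by positivity), mul_comm]
        refine le_of_eq_of_le ?_ h1
        congr 2
        simp [hLi, ← hS₀]; ring)
    have h1 : |a i + S₀ + Li s| ≤ O / h₀ ^ 2 + (r / 4)⁻¹ ^ 2 * k₁ * Me + (r / 4)⁻¹ * k₂ * Mp := by
      rw [← mul_le_mul_iff_of_pos_right hb]
      refine key.trans (le_of_eq ?_)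
      rw [hk₁, hk₂]; field_simp
    rw [le_div_iff₀ (by positivity)]
    have h2 : |a i + S₀ + Li s| * h₀ ^ 2 ≤
        O + (h₀ / (r / 4)) ^ 2 * k₁ * Me + (h₀ / (r / 4)) * k₂ * (h₀ * Mp) := by
      refine (mul_le_mul_of_nonneg_right h1 (by positivity)).trans (le_of_eq ?_)
      field_simp
    refine h2.trans ?_
    have h3 : (h₀ / (r / 4)) ^ 2 * k₁ * Me ≤ (8 * σ) ^ 2 * k₁ * Me := by gcongr
    have h4 : (h₀ / (r / 4)) * k₂ * (h₀ * Mp) ≤ (8 * σ) * k₂ * (h₀ * Mp) := by gcongr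
    have h5 : 0 ≤ 64 * σ ^ 2 * k₁ * (h₀ * Mp + O) := by positivity
    have h6 : 0 ≤ 8 * σ * k₂ * (Me + O) := by positivity
    have h7 : 0 ≤ Me + h₀ * Mp := by positivity
    rw [hN, hX]
    linarith
  filter_upwards [ho, hproj] with x hx hxp hxT
  have h1 := hx hxT i
  rw [hxp hxT] at h1
  have h2 := abs_affine_le (by positivity : 0 < r / 2) hh hmean
    (dist_le_size hxT hel.center_mem) (by simp)
  have h3 : 2 * (h₀ / (r / 2)) ≤ 8 * σ := by
    have : 2 * (h₀ / (r / 2)) = h₀ / (r / 4) := by field_simp; norm_num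
    rw [this]; exact hhr
  have h4 : h₀ ^ 2 * |(a i + S₀) + Li x| ≤ (1 + 8 * σ) * (N * X) := by
    calc h₀ ^ 2 * |(a i + S₀) + Li x| ≤
          h₀ ^ 2 * ((1 + 2 * (h₀ / (r / 2))) * (N * X / h₀ ^ 2)) := by gcongr
      _ ≤ h₀ ^ 2 * ((1 + 8 * σ) * (N * X / h₀ ^ 2)) := by gcongr
      _ = _ := by field_simp
  have h5 : |f x i + S₀| ≤ |f x i - (L x + a) i| + |(a i + S₀) + Li x| := by
    refine le_of_eq_of_le ?_ (abs_add_le _ _)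
    congr 1
    simp [hLi]; ring
  have h6 : O ≤ N * X := by
    have : 0 ≤ 64 * σ ^ 2 * k₁ * X := by positivity
    have : 0 ≤ 8 * σ * k₂ * X := by positivity
    have : 0 ≤ Me + h₀ * Mp := by positivity
    rw [hN]; linarith
  calc h₀ ^ 2 * |f x i + S₀| ≤ h₀ ^ 2 * (|f x i - (L x + a) i| + |(a i + S₀) + Li x|) := by gcongr
    _ ≤ O + (1 + 8 * σ) * (N * X) := by rw [mul_add]; exact add_le_add h1 h4
    _ ≤ residualConst d σ * X := by rw [residualConst]; linarith

/-- Efficiency of the divergence. -/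
theorem IsElement.div_le (hd : 0 < d) (hΩ : IsConvexPolytopalDomain Ω)
    (h : IsStokesSolution Ω f y p) (hel : IsElement T z r)
    (hσ : size T ≤ σ * (2 * r)) (hσ0 : 0 ≤ σ) (hTΩ : cell T ⊆ closure Ω)
    (hloc : IsLocalForm T yT pT c ℓ B α m) (hMe : 0 ≤ Me)
    (he : ∀ᵐ x, x ∈ cell T → ∀ i, |y x i - yT x i| ≤ Me) {x : E d} (hx : x ∈ cell T) :
    size T * |∑ i, fderiv ℝ (quad (c i) (ℓ i) (B i)) x (stdVec i)| ≤ divConst d σ * Me := by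
  have hr := hel.pos
  have hb := bumpMass_pos (d := d)
  have hg := bumpGrad_nonneg (d := d)
  set h₀ := size T with hh₀
  have hh : 0 < h₀ := by linarith [hel.two_mul_le_size hd]
  have hhr : h₀ / (r / 4) ≤ 8 * σ := by rw [div_le_iff₀ (by positivity)]; linarith
  set a := ∑ i, ℓ i (stdVec i) with ha
  set L : E d →L[ℝ] ℝ := ∑ i, ((B i).flip (stdVec i) + B i (stdVec i)) with hL
  have hdiv : ∀ x, ∑ i, fderiv ℝ (quad (c i) (ℓ i) (B i)) x (stdVec i) = a + L x := by
    intro x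
    simp_rw [fderiv_quad]
    rw [Finset.sum_add_distrib, hL, sum_apply, ha]
    simp
  set k₂ := bumpGrad d / bumpMass d with hk₂
  have hk₂0 : 0 ≤ k₂ := by positivity
  have hmean : ∀ s ∈ Metric.closedBall z (r / 2), ⟪(0 : E d), s - z⟫ = 0 →
      |a + L s| ≤ 8 * σ * k₂ * Me / h₀ := by
    intro s hs _
    have hsub := hel.closedBall_subset hs
    have hsubT : Metric.closedBall s (r / 4) ⊆ cell T :=
      (hsub.trans Metric.ball_subset_closedBall).trans hel.ball
    have key := h.div_bound (by positivity : 0 < r / 4) (hsub.trans (hel.ball_subset hΩ hTΩ))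
      (fun x hx => hloc.vel x (hsubT hx)) (he.mono fun x hx hxs => hx (hsubT hxs))
      (A := a + L s) (L := L) (fun x => by rw [hdiv, map_sub]; ring)
    have h1 : |a + L s| ≤ (r / 4)⁻¹ * k₂ * Me := by
      rw [← mul_le_mul_iff_of_pos_right hb]
      refine key.trans (le_of_eq ?_)
      rw [hk₂]; field_simp
    rw [le_div_iff₀ hh]
    calc |a + L s| * h₀ ≤ (r / 4)⁻¹ * k₂ * Me * h₀ := by gcongr
      _ = h₀ / (r / 4) * k₂ * Me := by field_simp
      _ ≤ 8 * σ * k₂ * Me := by gcongr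
  have h2 := abs_affine_le (by positivity : 0 < r / 2) hh hmean
    (dist_le_size hx hel.center_mem) (by simp)
  have h3 : 2 * (h₀ / (r / 2)) ≤ 8 * σ := by
    have : 2 * (h₀ / (r / 2)) = h₀ / (r / 4) := by field_simp; norm_num
    rw [this]; exact hhr
  rw [hdiv]
  calc h₀ * |a + L x| ≤ h₀ * ((1 + 2 * (h₀ / (r / 2))) * (8 * σ * k₂ * Me / h₀)) := by gcongr
    _ ≤ h₀ * ((1 + 8 * σ) * (8 * σ * k₂ * Me / h₀)) := by gcongr
    _ = divConst d σ * Me := by rw [divConst, ← hk₂]; field_simp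

end element

section jump

variable {Ω : Set (E d)} {f y yT : E d → E d} {p pT : E d → ℝ} {T T' S : Finset (E d)}
  {z z' ν : E d} {r r' σ : ℝ} {c c' : Fin d → ℝ} {ℓ ℓ' : Fin d → E d →L[ℝ] ℝ}
  {B B' : Fin d → E d →L[ℝ] E d →L[ℝ] ℝ} {α α' : ℝ} {m m' : E d →L[ℝ] ℝ} {Me Mp O : ℝ}

/-- The coefficients of a quadratic function that factors through `ν · (x - s)`. -/
theorem quad_coeffs_of_eq {c : ℝ} {ℓ : E d →L[ℝ] ℝ} {B : E d →L[ℝ] E d →L[ℝ] ℝ} {s w : E d}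
    {a : ℝ} (h : ∀ x, quad c ℓ B x = ⟪ν, x - s⟫ * (a + ⟪w, x - s⟫)) :
    ∑ j, 2 * B (stdVec j) (stdVec j) = 2 * ⟪ν, w⟫ ∧
      ∀ x, ⟪ν, x - s⟫ = 0 → ‖ν‖ = 1 → fderiv ℝ (quad c ℓ B) x ν = a + ⟪w, x - s⟫ := by
  -- Second differences at `s`.
  have hB : ∀ u, B u u = ⟪ν, u⟫ * ⟪w, u⟫ := by
    intro u
    have h0 := h s
    have h1 := h (s + u)
    have h2 := h (s - u)
    simp only [quad, map_add, map_sub, add_apply, sub_apply, sub_self, inner_zero_right,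
      add_sub_cancel_left, sub_sub_cancel_left, inner_neg_right] at h0 h1 h2
    linarith
  constructor
  · simp_rw [hB, inner_stdVec]
    rw [← Finset.mul_sum, sum_mul_stdVec]
  · -- For a quadratic function the central difference quotient is exact.
    intro x hx hν
    have h1 := h (x + ν)
    have h2 := h (x - ν)
    rw [fderiv_quad]
    have e1 : x + ν - s = (x - s) + ν := by abel
    have e2 : x - ν - s = (x - s) - ν := by abel
    rw [e1, inner_add_right, inner_add_right, hx, real_inner_self_eq_norm_sq, hν] at h1
    rw [e2, inner_sub_right (x := ν), inner_sub_right (x := w) (y := x - s), hx,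
      real_inner_self_eq_norm_sq, hν] at h2
    simp only [quad, map_add, map_sub, add_apply, sub_apply] at h1 h2
    linarith

/-- Efficiency of the jump. The ball around the centroid of the side has radius `h_T / (d σ²)`, for
which it is contained in the union of the two elements. -/
theorem jump_le (hd : 2 ≤ d) (hΩ : IsConvexPolytopalDomain Ω)
    (h : IsStokesSolution Ω f y p) (hf : MemLp f ∞ (volume.restrict Ω))
    (hel : IsElement T z r) (hel' : IsElement T' z' r')
    (hσ : size T ≤ σ * (2 * r)) (hσ' : size T' ≤ σ * (2 * r')) (hσ1 : 1 ≤ σ)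
    (hTΩ : cell T ⊆ closure Ω) (hTΩ' : cell T' ⊆ closure Ω)
    (hloc : IsLocalForm T yT pT c ℓ B α m) (hloc' : IsLocalForm T' yT pT c' ℓ' B' α' m')
    (hS : S.card = d) (hST : S ⊆ T) (hST' : S ⊆ T') (hν : IsUnitNormal S T ν)
    (hν' : IsUnitNormal S T' (-ν)) (hMe : 0 ≤ Me) (hMp : 0 ≤ Mp) (hO : 0 ≤ O)
    (he : ∀ᵐ x, x ∈ cell T → ∀ i, |y x i - yT x i| ≤ Me)
    (he' : ∀ᵐ x, x ∈ cell T' → ∀ i, |y x i - yT x i| ≤ Me)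
    (hε : ∀ᵐ x, x ∈ cell T → |p x - pT x| ≤ Mp)
    (hε' : ∀ᵐ x, x ∈ cell T' → |p x - pT x| ≤ Mp)
    (ho : ∀ᵐ x, x ∈ cell T → ∀ i, size T ^ 2 * |f x i - proj (cell T) f x i| ≤ O)
    (ho' : ∀ᵐ x, x ∈ cell T' → ∀ i, size T' ^ 2 * |f x i - proj (cell T') f x i| ≤ O)
    (i : Fin d) {x : E d} (hx : x ∈ cell S) :
    size T * |fderiv ℝ (quad (c i) (ℓ i) (B i)) x ν - fderiv ℝ (quad (c' i) (ℓ' i) (B' i)) x ν| ≤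
      jumpConst d σ (sideMass ν) * (Me + size T * Mp + O) := by
  have hd0 : 0 < d := by omega
  have hdR : (0 : ℝ) < d := by exact_mod_cast hd0
  have hσ0 : 0 ≤ σ := by linarith
  have hr := hel.pos
  have hr' := hel'.pos
  have hb := bumpMass_pos (d := d)
  have hg := bumpGrad_nonneg (d := d)
  have hl := bumpLap_nonneg (d := d)
  have hκ := sideMass_pos hν.1
  have hres := hel.residual_le hd0 hΩ h hf hσ hσ0 hTΩ hloc hMe hMp hO he hε ho i
  have hres' := hel'.residual_le hd0 hΩ h hf hσ' hσ0 hTΩ' hloc' hMe hMp hO he' hε' ho' i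
  have hsz := hel.size_le hd hσ hσ0 hS hST hST'
  have hsz' := hel'.size_le hd hσ' hσ0 hS hST' hST
  have hC := residualConst_nonneg (d := d) hσ0
  have hh' : 0 < size T' := by linarith [hel'.two_mul_le_size hd0]
  set h₀ := size T with hh₀
  set C₁ := residualConst d σ with hC₁
  have hh : 0 < h₀ := by linarith [hel.two_mul_le_size hd0]
  set X := Me + h₀ * Mp + O with hX
  have hX0 : 0 ≤ X := by positivity
  set s₀ := sideCenter S with hs₀
  set ρ₀ := h₀ / (d * σ ^ 2) with hρ₀
  have hρ₀pos : 0 < ρ₀ := by positivity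
  have hdρ : d * ρ₀ = h₀ / σ ^ 2 := by rw [hρ₀]; field_simp
  have hdρ1 : d * ρ₀ ≤ 2 * r := by
    rw [hdρ, div_le_iff₀ (by positivity)]
    calc h₀ ≤ σ * (2 * r) := hσ
      _ ≤ σ ^ 2 * (2 * r) := by gcongr; nlinarith
      _ = _ := by ring
  have hdρ2 : d * ρ₀ ≤ 2 * r' := by
    rw [hdρ, div_le_iff₀ (by positivity)]
    calc h₀ ≤ σ * size T' := hsz
      _ ≤ σ * (σ * (2 * r')) := by gcongr
      _ = _ := by ring
  have hT : ∀ x ∈ Metric.closedBall s₀ ρ₀, 0 ≤ ⟪ν, x - s₀⟫ → x ∈ cell T := fun x hx hp =>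
    hel.halfBall_subset hd0 hST hS hν hdρ1 hx hp
  have hT' : ∀ x ∈ Metric.closedBall s₀ ρ₀, ⟪ν, x - s₀⟫ ≤ 0 → x ∈ cell T' := fun x hx hp =>
    hel'.halfBall_subset hd0 hST' hS hν' hdρ2 hx (by
      rw [inner_neg_left]; exact neg_nonneg.2 hp)
  have hballΩ : Metric.ball s₀ ρ₀ ⊆ Ω := by
    refine hΩ.subset_of_isOpen Metric.isOpen_ball fun x hx => ?_
    have hx' := Metric.ball_subset_closedBall hx
    rcases le_total 0 ⟪ν, x - s₀⟫ with h0 | h0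
    · exact hTΩ (hT x hx' h0)
    · exact hTΩ' (hT' x hx' h0)
  -- The difference of the two polynomials vanishes on the side, by continuity.
  obtain ⟨a, w, hD⟩ : ∃ (a : ℝ) (w : E d), ∀ x, quad (c i - c' i) (ℓ i - ℓ' i) (B i - B' i) x =
      ⟪ν, x - s₀⟫ * (a + ⟪w, x - s₀⟫) := by
    refine quad_eq_of_vanish hν.1 s₀ hρ₀pos fun x hx h0 => ?_
    rw [← quad_sub, ← hloc.vel x (hT x hx h0.ge) i, ← hloc'.vel x (hT' x hx h0.le) i, sub_self]
  obtain ⟨k, hk⟩ : ∃ k : ℝ, ∀ x, (α - α') + (m - m') x = k * ⟪ν, x - s₀⟫ := by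
    refine affine_eq_of_vanish hν.1 s₀ hρ₀pos fun x hx h0 => ?_
    have e1 := hloc.pres x (hT x hx h0.ge)
    have e2 := hloc'.pres x (hT' x hx h0.le)
    simp only [sub_apply]; linarith
  obtain ⟨hlapD, hfD⟩ := quad_coeffs_of_eq hD
  have hlap : ∑ j, 2 * B i (stdVec j) (stdVec j) =
      (∑ j, 2 * B' i (stdVec j) (stdVec j)) + 2 * ⟪ν, w⟫ := by
    rw [← hlapD, ← Finset.sum_add_distrib]
    exact Finset.sum_congr rfl fun j _ => by simp only [sub_apply]; ring
  have hm : m (stdVec i) = m' (stdVec i) + k * ν i := by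
    have e1 := hk s₀
    have e2 := hk (s₀ + stdVec i)
    rw [sub_self, inner_zero_right] at e1
    rw [add_sub_cancel_left, inner_stdVec, map_add] at e2
    simp only [sub_apply] at e1 e2
    linarith
  -- The factor `σ ^ 3` arises when the size of `T'` is replaced by that of `T`.
  have hCX : ∀ᵐ x, x ∈ cell T' →
      |f x i + ((∑ j, 2 * B' i (stdVec j) (stdVec j)) - m' (stdVec i))| ≤
        σ ^ 3 * C₁ * X / h₀ ^ 2 := by
    filter_upwards [hres'] with x hx hxT
    rw [le_div_iff₀ (by positivity)]
    set R := |f x i + ((∑ j, 2 * B' i (stdVec j) (stdVec j)) - m' (stdVec i))|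
    have hR : 0 ≤ R := abs_nonneg _
    have e1 : Me + size T' * Mp + O ≤ σ * X := by
      have : size T' * Mp ≤ σ * h₀ * Mp := by gcongr
      have : 0 ≤ (σ - 1) * (Me + O) := mul_nonneg (by linarith) (by positivity)
      rw [hX]; linarith
    calc R * h₀ ^ 2 ≤ R * (σ * size T') ^ 2 := by gcongr
      _ = σ ^ 2 * (size T' ^ 2 * R) := by ring
      _ ≤ σ ^ 2 * (C₁ * (Me + size T' * Mp + O)) := by
          exact mul_le_mul_of_nonneg_left (hx hxT) (by positivity)
      _ ≤ σ ^ 2 * (C₁ * (σ * X)) := by gcongr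
      _ = _ := by ring
  have hCX' : ∀ᵐ x, x ∈ cell T →
      |f x i + ((∑ j, 2 * B i (stdVec j) (stdVec j)) - m (stdVec i))| ≤
        σ ^ 3 * C₁ * X / h₀ ^ 2 := by
    filter_upwards [hres] with x hx hxT
    rw [le_div_iff₀ (by positivity), mul_comm]
    refine (hx hxT).trans ?_
    have : 1 ≤ σ ^ 3 := one_le_pow₀ hσ1
    calc C₁ * X = 1 * (C₁ * X) := (one_mul _).symm
      _ ≤ σ ^ 3 * (C₁ * X) := by gcongr
      _ = _ := by ring
  set N := bumpMass d * (σ ^ 3 * C₁) + 4 * (d * σ ^ 2) * bumpLap d + bumpGrad d with hN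
  have hρh : ρ₀ ≤ h₀ := by
    rw [hρ₀, div_le_iff₀ (by positivity)]
    have h1 : (1 : ℝ) ≤ d := by exact_mod_cast hd0
    have h2 : (1 : ℝ) ≤ d * σ ^ 2 := one_le_mul_of_one_le_of_one_le h1 (one_le_pow₀ hσ1)
    calc h₀ = h₀ * 1 := (mul_one _).symm
      _ ≤ _ := by gcongr
  -- The bump functions are centred at the points of the side near its centroid.
  have hmean : ∀ s ∈ Metric.closedBall s₀ (ρ₀ / 2), ⟪ν, s - s₀⟫ = 0 →
      |(a - ⟪w, s₀⟫) + innerSL ℝ w s| ≤ N / sideMass ν * X / h₀ := by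
    intro s hs hsν
    have hsub : Metric.closedBall s (ρ₀ / 4) ⊆ Metric.ball s₀ ρ₀ := by
      intro x hx
      rw [Metric.mem_closedBall] at hs hx
      rw [Metric.mem_ball]
      linarith [dist_triangle x s s₀]
    have ht : ∀ x, ⟪ν, x - s⟫ = ⟪ν, x - s₀⟫ := by
      intro x
      rw [← sub_add_sub_cancel x s s₀, inner_add_right, hsν, add_zero]
    have hw : ∀ x, a + ⟪w, x - s₀⟫ = (a - ⟪w, s₀⟫ + innerSL ℝ w s) + ⟪w, x - s⟫ := by
      intro x
      simp only [innerSL_apply_apply, inner_sub_right]; ring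
    have hcb : ∀ x ∈ Metric.closedBall s (ρ₀ / 4), x ∈ Metric.closedBall s₀ ρ₀ := fun x hx =>
      Metric.ball_subset_closedBall (hsub hx)
    have key := h.jump_bound hΩ.isOpen hf (by positivity : 0 < ρ₀ / 4) (hsub.trans hballΩ)
      (yT := yT) (pT := pT) (i := i) hν.1 (c := c' i) (ℓ := ℓ' i) (B := B' i)
      (a := a - ⟪w, s₀⟫ + innerSL ℝ w s) (w := w) (α := α') (m := m') (k := k) (by
        intro x hx
        rw [ht, ← hw]
        rcases le_total 0 ⟪ν, x - s₀⟫ with h0 | h0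
        · rw [max_eq_left h0, hloc.vel x (hT x (hcb x hx) h0) i, ← hD, ← quad_sub]; ring
        · rw [max_eq_right h0, hloc'.vel x (hT' x (hcb x hx) h0) i]; ring) (by
        intro x hx
        rw [ht]
        rcases le_total 0 ⟪ν, x - s₀⟫ with h0 | h0
        · rw [max_eq_left h0, hloc.pres x (hT x (hcb x hx) h0), ← hk]
          simp only [sub_apply]; ring
        · rw [max_eq_right h0, hloc'.pres x (hT' x (hcb x hx) h0)]; ring)
      (Me := Me) (Mr := σ ^ 3 * C₁ * X / h₀ ^ 2) hMp (by
        filter_upwards [he, he'] with x h1 h2 hxs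
        rcases le_total 0 ⟪ν, x - s₀⟫ with h0 | h0
        · exact h1 (hT x (hcb x hxs) h0) i
        · exact h2 (hT' x (hcb x hxs) h0) i) (by
        filter_upwards [hε, hε'] with x h1 h2 hxs
        rcases le_total 0 ⟪ν, x - s₀⟫ with h0 | h0
        · exact h1 (hT x (hcb x hxs) h0)
        · exact h2 (hT' x (hcb x hxs) h0)) (by
        filter_upwards [hCX, hCX'] with x h1 h2 hxs
        by_cases h0 : x ∈ halfSpace ν s
        · rw [indicator_of_mem h0]
          have h0' : 0 < ⟪ν, x - s₀⟫ := by rw [← ht]; exact h0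
          have := h2 (hT x (hcb x hxs) h0'.le)
          rw [hlap, hm] at this
          refine le_of_eq_of_le ?_ this
          congr 1; ring
        · rw [indicator_of_notMem h0, add_zero]
          have h0' : ⟪ν, x - s₀⟫ ≤ 0 := by rw [← ht]; exact not_lt.1 h0
          exact h1 (hT' x (hcb x hxs) h0'))
    rw [le_div_iff₀ hh, div_mul_eq_mul_div, le_div_iff₀ hκ]
    have e1 : h₀ * (ρ₀ / 4)⁻¹ = 4 * (d * σ ^ 2) := by rw [hρ₀]; field_simp
    have e2 : h₀ * ((ρ₀ / 4) * bumpMass d * (σ ^ 3 * C₁ * X / h₀ ^ 2)) ≤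
        bumpMass d * (σ ^ 3 * C₁) * X := by
      calc h₀ * ((ρ₀ / 4) * bumpMass d * (σ ^ 3 * C₁ * X / h₀ ^ 2)) =
            ρ₀ / 4 / h₀ * (bumpMass d * (σ ^ 3 * C₁) * X) := by field_simp
        _ ≤ 1 * (bumpMass d * (σ ^ 3 * C₁) * X) := by
            gcongr; rw [div_le_one hh]; linarith
        _ = _ := one_mul _
    have e3 : Me ≤ X := by
      have : 0 ≤ h₀ * Mp + O := by positivity
      rw [hX]; linarith
    have e4 : h₀ * Mp ≤ X := by
      have : 0 ≤ Me + O := by positivity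
      rw [hX]; linarith
    have e5 : 4 * (d * σ ^ 2) * bumpLap d * Me ≤ 4 * (d * σ ^ 2) * bumpLap d * X := by gcongr
    have e6 : bumpGrad d * (h₀ * Mp) ≤ bumpGrad d * X := by gcongr
    have e7 := mul_le_mul_of_nonneg_left key hh.le
    have e8 : h₀ * ((ρ₀ / 4)⁻¹ * bumpLap d * Me) = 4 * (d * σ ^ 2) * bumpLap d * Me := by
      rw [← e1]; ring
    rw [hN]
    linarith
  have hs₀T : s₀ ∈ cell T := hT s₀ (Metric.mem_closedBall_self hρ₀pos.le) (by simp)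
  have hxT : x ∈ cell T := convexHull_mono (by exact_mod_cast hST) hx
  have hxν : ⟪ν, x - s₀⟫ = 0 := inner_eq_zero_of_mem_cell hd0 hS hν.2.1 hx
  have h2 := abs_affine_le (by positivity : 0 < ρ₀ / 2) hh hmean (dist_le_size hxT hs₀T) hxν
  have h3 : fderiv ℝ (quad (c i) (ℓ i) (B i)) x ν - fderiv ℝ (quad (c' i) (ℓ' i) (B' i)) x ν =
      (a - ⟪w, s₀⟫) + innerSL ℝ w x := by
    have e1 := hfD x hxν hν.1
    rw [fderiv_quad] at e1 ⊢
    rw [fderiv_quad]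
    simp only [sub_apply] at e1
    rw [innerSL_apply_apply]
    rw [inner_sub_right] at e1
    linarith
  have h4 : 2 * (h₀ / (ρ₀ / 2)) = 4 * (d * σ ^ 2) := by rw [hρ₀]; field_simp; norm_num
  rw [h4] at h2
  rw [h3]
  calc h₀ * |(a - ⟪w, s₀⟫) + innerSL ℝ w x| ≤
        h₀ * ((1 + 4 * (d * σ ^ 2)) * (N / sideMass ν * X / h₀)) := by gcongr
    _ = jumpConst d σ (sideMass ν) * X := by
        rw [jumpConst, ← hC₁, ← hN]; field_simp

end jump

/-! ### The local lower bound for the error -/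

theorem norm_le_of_components {v : E d} {M : ℝ} (h : ∀ i, |v i| ≤ M) : ‖v‖ ≤ d * M := by
  have e : v = ∑ i, v i • stdVec i := by
    ext j; simp [stdVec, Finset.sum_apply, Pi.single_apply]
  calc ‖v‖ = ‖∑ i, v i • stdVec i‖ := by rw [← e]
    _ ≤ ∑ i : Fin d, M := norm_sum_le_of_le _ fun i _ => by
        rw [norm_smul]; simpa using h i
    _ = d * M := by simp

theorem abs_apply_le_norm (v : E d) (i : Fin d) : |v i| ≤ ‖v‖ := by
  simpa using PiLp.norm_apply_le v i

/-- A scaled `L^∞`-norm is bounded by a scaled pointwise bound. -/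
theorem ofReal_mul_eLpNorm_le {F : Type*} [NormedAddCommGroup F] {μ : Measure (E d)}
    {g : E d → F} {h M : ℝ} (hh : 0 < h) (hg : ∀ᵐ x ∂μ, h * ‖g x‖ ≤ M) :
    ENNReal.ofReal h * eLpNorm g ∞ μ ≤ ENNReal.ofReal M := by
  have h1 : eLpNorm g ∞ μ ≤ ENNReal.ofReal (M / h) := by
    rw [eLpNorm_exponent_top]
    refine eLpNormEssSup_le_of_ae_enorm_bound ?_
    filter_upwards [hg] with x hx
    rw [← ofReal_norm]
    exact ENNReal.ofReal_le_ofReal (by rw [le_div_iff₀ hh, mul_comm]; exact hx)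
  calc ENNReal.ofReal h * eLpNorm g ∞ μ ≤ ENNReal.ofReal h * ENNReal.ofReal (M / h) := by gcongr
    _ = ENNReal.ofReal M := by
        rw [← ENNReal.ofReal_mul hh.le]; congr 1; field_simp

theorem ae_norm_le_toReal {F : Type*} [NormedAddCommGroup F] {s t : Set (E d)} (hst : s ⊆ t)
    (hs : MeasurableSet s) {g : E d → F} (h : eLpNorm g ∞ (volume.restrict t) ≠ ⊤) :
    ∀ᵐ x, x ∈ s → ‖g x‖ ≤ (eLpNorm g ∞ (volume.restrict t)).toReal := by
  rw [← ae_restrict_iff' hs]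
  refine ae_mono (Measure.restrict_mono hst le_rfl) ?_
  rw [eLpNorm_exponent_top] at h ⊢
  filter_upwards [ae_le_eLpNormEssSup (f := g) (μ := volume.restrict t)] with x hx
  rw [← toReal_enorm]
  exact ENNReal.toReal_mono h hx

end TaylorHood
end

theorem mainTheorem4 (d : ℕ) (hd : d = 2 ∨ d = 3) (σ : ℝ) :
    ∃ C : ℝ≥0, ∀ Ω : Set (TaylorHood.E d), TaylorHood.IsConvexPolytopalDomain Ω →
      ∀ K : Geometry.SimplicialComplex ℝ (TaylorHood.E d),
        TaylorHood.IsMesh Ω K → TaylorHood.IsShapeRegular K σ →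
      ∀ f : TaylorHood.E d → TaylorHood.E d, MemLp f ∞ (volume.restrict Ω) →
      ∀ (y : TaylorHood.E d → TaylorHood.E d) (p : TaylorHood.E d → ℝ),
        TaylorHood.IsStokesSolution Ω f y p →
      ∀ (yT : TaylorHood.E d → TaylorHood.E d) (pT : TaylorHood.E d → ℝ),
        TaylorHood.IsDiscreteStokesSolution Ω K f yT pT →
      ∀ T ∈ K.facets,
        TaylorHood.indicator K f yT pT T ≤
          C * (eLpNorm (fun x => y x - yT x) ∞ (volume.restrict (TaylorHood.patch K T)) +
            ENNReal.ofReal (TaylorHood.size T) *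
              eLpNorm (fun x => p x - pT x) ∞ (volume.restrict (TaylorHood.patch K T)) +
            TaylorHood.osc K f T) := by
  open TaylorHood in
  have hd2 : 2 ≤ d := by omega
  have hd0 : 0 < d := by omega
  set e₀ : E d := stdVec ⟨0, hd0⟩ with he₀
  have he₀n : ‖e₀‖ = 1 := by simp [he₀]
  set κ := sideMass e₀ with hκ
  have hκ0 : 0 < κ := sideMass_pos he₀n
  -- The summand `1` makes the constant nonzero, for the case of an infinite right-hand side.
  refine ⟨(d * residualConst d σ + d * jumpConst d σ κ + divConst d σ).toNNReal + 1, ?_⟩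
  intro Ω hΩ K hK hreg f hf y p h yT pT hdis T hT
  obtain ⟨z, r, hel, hσ⟩ := hK.exists_isElement hreg hT
  have hr := hel.pos
  have h2r := hel.two_mul_le_size hd0
  have hh : 0 < size T := by linarith
  -- An inscribed ball is not wider than the element.
  have hσ1 : 1 ≤ σ := by
    by_contra hcon
    have : σ * (2 * r) < 1 * (2 * r) := mul_lt_mul_of_pos_right (not_le.1 hcon) (by linarith)
    linarith
  have hσ0 : 0 ≤ σ := by linarith
  have hC1 := residualConst_nonneg (d := d) hσ0
  have hC2 := divConst_nonneg (d := d) hσ0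
  have hC3 := jumpConst_nonneg (d := d) hσ0 hκ0
  set X₁ := eLpNorm (fun x => y x - yT x) ∞ (volume.restrict (patch K T)) with hX₁
  set X₂ := eLpNorm (fun x => p x - pT x) ∞ (volume.restrict (patch K T)) with hX₂
  set X₃ := osc K f T with hX₃
  have hC0 : (((d * residualConst d σ + d * jumpConst d σ κ + divConst d σ).toNNReal + 1 : ℝ≥0) :
      ℝ≥0∞) ≠ 0 := by
    rw [Ne, ENNReal.coe_eq_zero]; positivity
  have hofh : ENNReal.ofReal (size T) ≠ 0 := by simpa using hh
  by_cases ht1 : X₁ = ⊤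
  · rw [ht1, top_add, top_add, ENNReal.mul_top hC0]; exact le_top
  by_cases ht2 : X₂ = ⊤
  · rw [ht2, ENNReal.mul_top hofh, add_top, top_add, ENNReal.mul_top hC0]; exact le_top
  by_cases ht3 : X₃ = ⊤
  · rw [ht3, add_top, ENNReal.mul_top hC0]; exact le_top
  set Me := X₁.toReal with hMe
  set Mp := X₂.toReal with hMp
  set O := X₃.toReal with hO
  have hMe0 : 0 ≤ Me := ENNReal.toReal_nonneg
  have hMp0 : 0 ≤ Mp := ENNReal.toReal_nonneg
  have hO0 : 0 ≤ O := ENNReal.toReal_nonneg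
  set X := Me + size T * Mp + O with hX
  have hX0 : 0 ≤ X := by positivity
  have hpatch : ∀ T' ∈ patchElements K T, cell T' ⊆ patch K T := fun T' hT' =>
    subset_biUnion_of_mem (u := fun T' => cell T') hT'
  have he : ∀ T' ∈ patchElements K T, ∀ᵐ x, x ∈ cell T' → ∀ i, |y x i - yT x i| ≤ Me := by
    intro T' hT'
    filter_upwards [ae_norm_le_toReal (hpatch T' hT') (isCompact_cell T').measurableSet ht1]
      with x hx hxT i
    exact (abs_apply_le_norm (y x - yT x) i).trans (hx hxT)
  have hε : ∀ T' ∈ patchElements K T, ∀ᵐ x, x ∈ cell T' → |p x - pT x| ≤ Mp := fun T' hT' =>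
    ae_norm_le_toReal (hpatch T' hT') (isCompact_cell T').measurableSet ht2
  have ho : ∀ T' ∈ patchElements K T, 0 < size T' → ∀ᵐ x, x ∈ cell T' →
      ∀ i, size T' ^ 2 * |f x i - proj (cell T') f x i| ≤ O := by
    intro T' hT' hh'
    set Y := eLpNorm (fun x => f x - proj (cell T') f x) ∞ (volume.restrict (cell T')) with hY
    have hle : ENNReal.ofReal (size T' ^ 2) * Y ≤ X₃ :=
      le_iSup₂ (f := fun T' (_ : T' ∈ patchElements K T) => ENNReal.ofReal (size T' ^ 2) *
        eLpNorm (fun x => f x - proj (cell T') f x) ∞ (volume.restrict (cell T'))) T' hT'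
    have hne : ENNReal.ofReal (size T' ^ 2) ≠ 0 := by
      rw [Ne, ENNReal.ofReal_eq_zero, not_le]; positivity
    have hYt : Y ≠ ⊤ := by
      intro hcon
      rw [hcon, ENNReal.mul_top hne, top_le_iff] at hle
      exact ht3 hle
    have hle' : size T' ^ 2 * Y.toReal ≤ O := by
      have := ENNReal.toReal_mono ht3 hle
      rwa [ENNReal.toReal_mul, ENNReal.toReal_ofReal (by positivity)] at this
    filter_upwards [ae_norm_le_toReal (subset_refl _) (isCompact_cell T').measurableSet hYt]
      with x hx hxT i
    refine (mul_le_mul_of_nonneg_left ?_ (by positivity)).trans hle'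
    exact (abs_apply_le_norm (f x - proj (cell T') f x) i).trans (hx hxT)
  have hTp : T ∈ patchElements K T := ⟨hT, Or.inl rfl⟩
  have hTΩ := hK.cell_subset_closure hT
  have hint : (interior (cell T)).Nonempty :=
    ⟨z, interior_mono hel.ball (by
      rw [interior_closedBall _ hr.ne']; exact Metric.mem_ball_self hr)⟩
  obtain ⟨c, ℓ, B, α, m, hloc⟩ := exists_isLocalForm hdis.memV hdis.memQ hT
  have b1 : ENNReal.ofReal (size T ^ 2) *
      eLpNorm (fun x => f x + Laplacian.laplacian yT x - gradient pT x) ∞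
        (volume.restrict (cell T)) ≤ ENNReal.ofReal (d * (residualConst d σ * X)) := by
    refine ofReal_mul_eLpNorm_le (by positivity) ?_
    rw [ae_restrict_iff' (isCompact_cell T).measurableSet]
    have hres := fun i => hel.residual_le hd0 hΩ h hf hσ hσ0 hTΩ hloc hMe0 hMp0 hO0
      (he T hTp) (hε T hTp) (ho T hTp hh) i
    filter_upwards [ae_all_iff.2 hres, ae_mem_interior_cell T] with x hx hxi hxT
    have hi := hxi hxT
    have : ‖f x + Laplacian.laplacian yT x - gradient pT x‖ ≤
        d * (residualConst d σ * X / size T ^ 2) := by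
      refine norm_le_of_components fun i => ?_
      rw [le_div_iff₀ (by positivity), mul_comm]
      refine le_of_eq_of_le ?_ (hx i hxT)
      rw [PiLp.sub_apply, PiLp.add_apply, hloc.laplacian_apply hi, hloc.gradient_pres_apply hi,
        add_sub_assoc]
    calc size T ^ 2 * ‖f x + Laplacian.laplacian yT x - gradient pT x‖ ≤
          size T ^ 2 * (d * (residualConst d σ * X / size T ^ 2)) := by gcongr
      _ = _ := by field_simp
  have b2 : ENNReal.ofReal (size T / 2) * jumpNorm K yT T ≤
      ENNReal.ofReal (d * (jumpConst d σ κ * X)) := by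
    unfold jumpNorm
    simp only [ENNReal.mul_iSup]
    refine iSup_le fun S => iSup_le fun hS => iSup_le fun T' => iSup_le fun hT' => iSup_le fun ν =>
      iSup_le fun hν => iSup_le fun ν' => iSup_le fun hν' => ?_
    obtain ⟨hT'K, hne, hST'⟩ := hT'
    have hScard := hS.1.2.1
    have hST := hS.2
    have hT'p : T' ∈ patchElements K T := by
      refine ⟨hT'K, Or.inr ⟨S, hS, ⟨hS.1.1, hScard, ?_⟩, hST'⟩⟩
      exact ⟨T, hT, T', hT'K, hne.symm, hST, hST'⟩
    obtain ⟨z', r', hel', hσ'⟩ := hK.exists_isElement hreg hT'K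
    have hh' : 0 < size T' := by linarith [hel'.two_mul_le_size hd0, hel'.pos]
    obtain rfl := hK.normal_eq_neg hd0 hT hT'K hne hScard hST hST' hel hel' hν hν'
    obtain ⟨c', ℓ', B', α', m', hloc'⟩ := exists_isLocalForm hdis.memV hdis.memQ hT'K
    have hint' : (interior (cell T')).Nonempty :=
      ⟨z', interior_mono hel'.ball (by
        rw [interior_closedBall _ hel'.pos.ne']; exact Metric.mem_ball_self hel'.pos)⟩
    refine ofReal_mul_eLpNorm_le (by positivity) ?_
    rw [ae_restrict_iff' (isCompact_cell S).measurableSet]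
    -- The bound holds at every point of the side, so that the surface measure plays no role.
    refine Filter.Eventually.of_forall fun x hx => ?_
    have hxT : x ∈ cell T := convexHull_mono (by exact_mod_cast hST) hx
    have hxT' : x ∈ cell T' := convexHull_mono (by exact_mod_cast hST') hx
    have : ‖jump yT T T' ν (-ν) x‖ ≤ d * (jumpConst d σ κ * X / size T) := by
      refine norm_le_of_components fun i => ?_
      rw [le_div_iff₀ hh, mul_comm, hκ, sideMass_eq he₀n hν.1]
      refine le_of_eq_of_le ?_ (jump_le hd2 hΩ h hf hel hel' hσ hσ' hσ1 hTΩ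
        (hK.cell_subset_closure hT'K) hloc hloc' hScard hST hST' hν hν' hMe0 hMp0 hO0
        (he T hTp) (he T' hT'p) (hε T hTp) (hε T' hT'p) (ho T hTp hh) (ho T' hT'p hh') i hx)
      rw [jump, PiLp.add_apply, map_neg, PiLp.neg_apply, hloc.fderivWithin_apply hxT hint,
        hloc'.fderivWithin_apply hxT' hint', sub_eq_add_neg]
    have hJ := norm_nonneg (jump yT T T' ν (-ν) x)
    calc size T / 2 * ‖jump yT T T' ν (-ν) x‖ ≤ size T * ‖jump yT T T' ν (-ν) x‖ := by
          gcongr; linarith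
      _ ≤ size T * (d * (jumpConst d σ κ * X / size T)) := by gcongr
      _ = _ := by field_simp
  have b3 : ENNReal.ofReal (size T) * eLpNorm (fun x => ∑ i, gradient (fun z => yT z i) x i) ∞
      (volume.restrict (cell T)) ≤ ENNReal.ofReal (divConst d σ * X) := by
    refine ofReal_mul_eLpNorm_le hh ?_
    rw [ae_restrict_iff' (isCompact_cell T).measurableSet]
    filter_upwards [ae_mem_interior_cell T] with x hxi hxT
    have := hel.div_le hd0 hΩ h hσ hσ0 hTΩ hloc hMe0 (he T hTp) hxT
    simp_rw [hloc.gradient_vel_apply (hxi hxT)]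
    refine this.trans (mul_le_mul_of_nonneg_left ?_ hC2)
    have : 0 ≤ size T * Mp + O := by positivity
    rw [hX]; linarith
  have hXe : ENNReal.ofReal X = X₁ + ENNReal.ofReal (size T) * X₂ + X₃ := by
    rw [hX, ENNReal.ofReal_add (by positivity) hO0, ENNReal.ofReal_add hMe0 (by positivity),
      ENNReal.ofReal_mul hh.le, ENNReal.ofReal_toReal ht1, ENNReal.ofReal_toReal ht2,
      ENNReal.ofReal_toReal ht3]
  rw [← hXe]
  calc indicator K f yT pT T ≤ ENNReal.ofReal (d * (residualConst d σ * X)) +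
        ENNReal.ofReal (d * (jumpConst d σ κ * X)) + ENNReal.ofReal (divConst d σ * X) :=
        add_le_add (add_le_add b1 b2) b3
    _ = ENNReal.ofReal (d * residualConst d σ + d * jumpConst d σ κ + divConst d σ) *
        ENNReal.ofReal X := by
        rw [← ENNReal.ofReal_add (by positivity) (by positivity),
          ← ENNReal.ofReal_add (by positivity) (by positivity),
          ← ENNReal.ofReal_mul (by positivity)]
        congr 1; ring
    _ ≤ _ := by
        gcongr
        rw [ENNReal.ofReal]
        exact_mod_cast le_self_add
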